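/- Let $F$ be Thompson's group of all piecewise linear homeomorphisms of $[0,1]$ with finitely many breakpoints, all dyadic, and with all slopes integer powers of $2$. It acts on the set of dyadic numbers in $[0,1]$; products in $F$ are compositions. Let $a,b\in F$ be the standard generators $$a(t)=\begin{cases}t/2,&t\le\frac12\\ t-\frac14,&\frac12\le t\le\frac34\\ 2t-1,&t\ge\frac34\end{cases}\qquad b(t)=\begin{cases}t,&t\le\frac12\\ \frac t2+\frac14,&\frac12\le t\le\frac34\\ t-\frac18,&\frac34\le t\le\frac78\\ 2t-1,&t\ge\frac78.\end{cases}$$ Let $\mathcal H$ be the Schreier graph, with respect to $\{a,b\}$, of the action of $F$ on the orbit of $p=1/2$, let $d$ be its graph distance, $B(x,n)=\{y: d(x,y)\le n\}$, $\partial B(x,n)=\{y:d(x,y)=n\}$, and let $|g|$ be the word length of $g\in F$ with respect to $\{a^{\pm1},b^{\pm1}\}$. Call $g\in F$ a geodesic (from $p$ to $g(p)$) if $|g|=d(p,g(p))$. The cone type $C(x)$ of a vertex $x$ is the set of all $g\in F$ such that for every geodesic $w$ with $w(p)=x$ the element $gw$ is a geodesic with $|gw|=|g|+|w|$. The orbit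 of $1/2$ is the set of dyadic numbers in $(0,1)$, and every geodesic $g$ is represented by exactly one word of length $|g|$ in $a^{\pm1},b^{\pm1}$. Call a vertex $x$ black if $x<\frac12$, grey if $\frac12\le x<\frac34$, and white if $x\ge\frac34$. Every vertex has exactly one of the following types, each type occurs, and two vertices have the same cone type if and only if they are of the same type: type 0: $x=\frac12$; type 1: black vertices; type 2: grey vertices other than $\frac12$; type 3: white vertices adjacent to a grey vertex other than $\frac12$; type 4: the other white vertices. Thus there are exactly five cone types $C_0,\dots,C_4$. Put $\Lambda_i^n=\sum_{g\in C_i,\,|g|=n}g\in\mathbb Z[F]$ and, for a vertex $x_i$ of type $i$, $L_i^n=\#\{g(x_i): g\in C_i,\ |g|=n\}$, the number of end points of the geodesic continuations of length $n$ from $x_i$. Then $\Lambda_i^0=1$, $L_i^0=1$, and for $n\ge1$ $$\begin{aligned}\Lambda^n_0&=\Lambda^{n-1}_1a+\Lambda^{n-1}_3a^{-1}, & L^n_0&=L^{n-1}_1+L^{n-1}_3,\\ \Lambda^n_1&=\Lambda^{n-1}_1a, & L^n_1&=L^{n-1}_1,\\ \Lambda^n_2&=\Lambda^{n-1}_1a+\Lambda^{n-1}_2b+\Lambda^{n-1}_3a^{-1},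 & L^n_2&=L^{n-1}_1+L^{n-1}_2+L^{n-1}_3,\\ \Lambda^n_3&=\Lambda^{n-1}_2b+\Lambda^{n-1}_4(a^{-1}+b^{-1}), & L^n_3&=L^{n-1}_2+L^{n-1}_4,\\ \Lambda^n_4&=\Lambda^{n-1}_4(a^{-1}+b^{-1}), & L^n_4&=L^{n-1}_4.\end{aligned}$$ Let $\mathbf A$, $A$, $B$ be the transition matrices $$\mathbf A=\begin{pmatrix}0&a&0&a^{-1}&0\\0&a&0&0&0\\0&a&b&a^{-1}&0\\0&0&b&0&a^{-1}+b^{-1}\\0&0&0&0&a^{-1}+b^{-1}\end{pmatrix},\quad A=\begin{pmatrix}0&1&0&1&0\\0&1&0&0&0\\0&1&1&1&0\\0&0&1&0&2\\0&0&0&0&2\end{pmatrix},\quad B=\begin{pmatrix}0&1&0&1&0\\0&1&0&0&0\\0&1&1&1&0\\0&0&1&0&1\\0&0&0&0&1\end{pmatrix},$$ and let $\mathbf 1$ be the vector with all entries $1$. As formal power series in a central variable $z$, the row vector $\tilde L(z)=\sum_n(\Lambda_0^n,\dots,\Lambda_4^n)z^n$ is $\tilde L(z)=\mathbf 1^T(I-z\mathbf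 A^T)^{-1}$, where $I-z\mathbf A^T$ is invertible, and its first coordinate is the complete geodesic growth function $\sum_{g\text{ geodesic}}g\,z^{|g|}$. Moreover $$\Big(\sum_n\#\{g\in C_i:|g|=n\}z^n\Big)_{i=0}^4=(I-zA)^{-1}\mathbf 1=\Big(\tfrac1{1-2z},\tfrac1{1-z},\tfrac1{1-3z+2z^2},\tfrac1{1-3z+2z^2},\tfrac1{1-2z}\Big),$$ $$\Big(\sum_nL_i^nz^n\Big)_{i=0}^4=(I-zB)^{-1}\mathbf 1=\Big(\tfrac{1+z}{1-z-z^2},\tfrac1{1-z},\tfrac{1+z}{1-2z+z^3},\tfrac1{1-2z+z^3},\tfrac1{1-z}\Big).$$ Consequently the geodesic growth function is $l(z)=\sum_{g\text{ geodesic}}z^{|g|}=\frac1{1-2z}$, and, with $\varphi=\frac{1+\sqrt5}2$ and $\hat\varphi=\frac{1-\sqrt5}2$, the orbit growth function is $$\hat l(z)=\sum_{n\ge0}\#\{g(p): g\text{ geodesic},\ |g|=n\}\,z^n=\frac{1+z}{1-z-z^2}=\frac{\varphi^2}{\sqrt5(1-\varphi z)}-\frac{\hat\varphi^2}{\sqrt5(1-\hat\varphi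 z)}.$$ For all $n\ge0$, $$|\partial B(p,n)|=\frac{\varphi^{n+2}-\hat\varphi^{n+2}}{\sqrt5},\qquad |B(p,n)|=\frac{\varphi^{n+3}-\varphi^2}{\sqrt5(\varphi-1)}-\frac{\hat\varphi^{n+3}-\hat\varphi^2}{\sqrt5(\hat\varphi-1)}.$$ -/

import Mathlib

/-! ## Schreier graphs, geodesics and cone types -/

section Schreier

variable {G X : Type*} [Group G] [MulAction G X]

/-- The (undirected) Schreier graph of the action of `G` on `X` with respect to `S ⊆ G`: the
vertices `x` and `s • x` are joined for every `s ∈ S`. Loops and multiplicities of edges, which do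
not influence distances, are not recorded here; they are visible in the words below. -/
def schreierGraph (S : Set G) (X : Type*) [MulAction G X] : SimpleGraph X :=
  SimpleGraph.fromRel fun x y => ∃ s ∈ S, s • x = y

/-- The list `u = [s₁, …, sₙ]` of elements of `S ∪ S⁻¹` is a word for `g`, i.e. `g = s₁ ⋯ sₙ`. -/
def IsWordFor (S : Set G) (u : List G) (g : G) : Prop :=
  (∀ s ∈ u, s ∈ S ∨ s⁻¹ ∈ S) ∧ u.prod = g

/-- The word length `|g|` with respect to `S` (equal to `⊤` if `g` is not generated by `S`). -/
noncomputable def wordLength (S : Set G) (g : G) : ℕ∞ :=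
  ⨅ (u : List G) (_ : IsWordFor S u g), (u.length : ℕ∞)

/-- The sphere `∂B(x, n)` of a graph. -/
def graphSphere {V : Type*} (H : SimpleGraph V) (x : V) (n : ℕ) : Set V := {y | H.edist x y = n}

/-- The ball `B(x, n)` of a graph. -/
def graphBall {V : Type*} (H : SimpleGraph V) (x : V) (n : ℕ) : Set V := {y | H.edist x y ≤ n}

/-- `g` is a geodesic of length `n` from `p` to `g • p`:
both `|g|` and the distance from `p` to `g • p` in the Schreier graph are equal to `n`. -/
def IsGeodesicOfLength (S : Set G) (p : X) (g : G) (n : ℕ) : Prop :=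
  wordLength S g = n ∧ (schreierGraph S X).edist p (g • p) = n

/-- The cone type of `x` with respect to the base point `p`: all `g` such that every geodesic `w`
from `p` to `x`, followed by `g`, is a geodesic. The action is a left action, so
"`w` followed by `g`" is `g * w`; its length is the sum of the two lengths. -/
def coneType (S : Set G) (p x : X) : Set G :=
  {g | ∀ (w : G) (m : ℕ), IsGeodesicOfLength S p w m → w • p = x →
    ∃ n : ℕ, wordLength S g = n ∧ IsGeodesicOfLength S p (g * w) (n + m)}

/-- The elements of length `n` in the cone type of `x`. -/
def coneLevel (S : Set G) (p x : X) (n : ℕ) : Set G :=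
  {g | g ∈ coneType S p x ∧ wordLength S g = n}

/-- `Λⁿ = ∑ g`, the sum over the elements `g` of length `n` in the cone type of `x`,
in the group ring. -/
noncomputable def coneSum (S : Set G) (p x : X) (n : ℕ) : MonoidAlgebra ℤ G :=
  ∑ᶠ g ∈ coneLevel S p x n, MonoidAlgebra.of ℤ G g

/-- `Lⁿ`, the number of different points to which the elements of length `n` in the cone type
of `x` lead from `x`. -/
noncomputable def coneOrbitCount (S : Set G) (p x : X) (n : ℕ) : ℕ :=
  {y : X | ∃ g ∈ coneLevel S p x n, g • x = y}.ncard

/-- The complete geodesic growth function `∑ g z^|g|`, over all geodesics `g` starting at `p`. -/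
noncomputable def completeGeodesicGrowth (S : Set G) (p : X) : PowerSeries (MonoidAlgebra ℤ G) :=
  PowerSeries.mk fun n => ∑ᶠ g ∈ {g : G | IsGeodesicOfLength S p g n}, MonoidAlgebra.of ℤ G g

/-- The geodesic growth function `∑ z^|g|`, over all geodesics `g` starting at `p`. -/
noncomputable def geodesicGrowth (S : Set G) (p : X) : PowerSeries ℝ :=
  PowerSeries.mk fun n => ({g : G | IsGeodesicOfLength S p g n}.ncard : ℝ)

/-- The orbit growth function `∑ #{x : x = g • p for a geodesic g of length n} zⁿ`. -/
noncomputable def orbitGrowth (S : Set G) (p : X) : PowerSeries ℝ :=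
  PowerSeries.mk fun n => ({x : X | ∃ g : G, IsGeodesicOfLength S p g n ∧ g • p = x}.ncard : ℝ)

end Schreier

/-! ## Thompson's group `F` and its action on the dyadic numbers -/

namespace Thompson

open unitInterval

/-- Dyadic rational numbers. -/
def IsDyadic (x : ℝ) : Prop := ∃ (m : ℤ) (n : ℕ), x = m / 2 ^ n

theorem IsDyadic.add {x y : ℝ} (hx : IsDyadic x) (hy : IsDyadic y) : IsDyadic (x + y) := by
  obtain ⟨m, n, rfl⟩ := hx
  obtain ⟨m', n', rfl⟩ := hy
  refine ⟨m * 2 ^ n' + m' * 2 ^ n, n + n', ?_⟩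
  push_cast
  rw [pow_add]
  field_simp

theorem IsDyadic.sub {x y : ℝ} (hx : IsDyadic x) (hy : IsDyadic y) : IsDyadic (x - y) := by
  obtain ⟨m', n', rfl⟩ := hy
  rw [sub_eq_add_neg]
  exact hx.add ⟨-m', n', by push_cast; ring⟩

theorem IsDyadic.zpow_mul {x : ℝ} (hx : IsDyadic x) (k : ℤ) : IsDyadic ((2 : ℝ) ^ k * x) := by
  obtain ⟨m, n, rfl⟩ := hx
  obtain ⟨j, rfl | rfl⟩ := k.eq_nat_or_neg
  · exact ⟨2 ^ j * m, n, by push_cast; rw [zpow_natCast]; ring⟩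
  · exact ⟨m, j + n, by rw [zpow_neg, zpow_natCast, pow_add]; field_simp⟩

/-- `f` is affine with slope an integer power of `2` on every interval whose interior does not
meet `B`. -/
def IsAffineOff (B : Finset I) (f : I ≃ₜ I) : Prop :=
  ∀ t u : I, t < u → (∀ s ∈ B, ¬ (t < s ∧ s < u)) →
    ∃ k : ℤ, ∀ x ∈ Set.Icc t u, ∀ y ∈ Set.Icc t u, (f y : ℝ) - f x = 2 ^ k * ((y : ℝ) - x)

/-- `f` is piecewise linear with finitely many breakpoints, all of them dyadic, and all its slopes
are integer powers of `2`. -/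
def IsThompson (f : I ≃ₜ I) : Prop :=
  ∃ B : Finset I, (∀ s ∈ B, IsDyadic s) ∧ IsAffineOff B f

theorem IsAffineOff.key {B : Finset I} {f : I ≃ₜ I} (hB : ∀ s ∈ B, IsDyadic s)
    (h : IsAffineOff B f) (n : ℕ) : ∀ t u : I, t < u →
      (B.filter fun s => t < s ∧ s < u).card = n →
      f t < f u ∧ (IsDyadic t → IsDyadic u → IsDyadic ((f u : ℝ) - f t)) := by
  induction n using Nat.strong_induction_on with
  | _ n ih =>
    intro t u htu hc
    by_cases hs : ∃ s ∈ B, t < s ∧ s < u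
    · obtain ⟨s, hsB, hts, hsu⟩ := hs
      have h1 : (B.filter fun r => t < r ∧ r < s).card < n := by
        rw [← hc]
        refine Finset.card_lt_card (Finset.ssubset_iff_subset_ne.2 ⟨fun r hr => ?_, fun he => ?_⟩)
        · simp only [Finset.mem_filter] at hr ⊢
          exact ⟨hr.1, hr.2.1, hr.2.2.trans hsu⟩
        · have : s ∈ B.filter fun r => t < r ∧ r < s := by
            rw [he]; simp [hsB, hts, hsu]
          simp at this
      have h2 : (B.filter fun r => s < r ∧ r < u).card < n := by
        rw [← hc]
        refine Finset.card_lt_card (Finset.ssubset_iff_subset_ne.2 ⟨fun r hr => ?_, fun he => ?_⟩)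
        · simp only [Finset.mem_filter] at hr ⊢
          exact ⟨hr.1, hts.trans hr.2.1, hr.2.2⟩
        · have : s ∈ B.filter fun r => s < r ∧ r < u := by
            rw [he]; simp [hsB, hts, hsu]
          simp at this
      obtain ⟨a1, b1⟩ := ih _ h1 t s hts rfl
      obtain ⟨a2, b2⟩ := ih _ h2 s u hsu rfl
      refine ⟨a1.trans a2, fun ht hu => ?_⟩
      have := (b1 ht (hB s hsB)).add (b2 (hB s hsB) hu)
      convert this using 1
      ring
    · push Not at hs
      obtain ⟨k, hk⟩ := h t u htu fun s hsB hst => absurd hst.2 (not_lt.2 (hs s hsB hst.1))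
      have e := hk t ⟨le_rfl, htu.le⟩ u ⟨htu.le, le_rfl⟩
      refine ⟨?_, fun ht hu => ?_⟩
      · have : (0 : ℝ) < 2 ^ k * ((u : ℝ) - t) :=
          mul_pos (by positivity) (sub_pos.2 (Subtype.coe_lt_coe.2 htu))
        rw [← e] at this
        exact Subtype.coe_lt_coe.1 (sub_pos.1 this)
      · rw [e]
        exact (hu.sub ht).zpow_mul k

theorem IsThompson.strictMono {f : I ≃ₜ I} (h : IsThompson f) : StrictMono f := by
  obtain ⟨B, hB, h⟩ := h
  exact fun t u htu => (h.key hB _ t u htu rfl).1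

theorem IsThompson.map_zero {f : I ≃ₜ I} (h : IsThompson f) : f 0 = 0 := by
  obtain ⟨x, hx⟩ := f.surjective 0
  have : f 0 ≤ f x := h.strictMono.monotone unitInterval.nonneg'
  rw [hx] at this
  exact le_antisymm this unitInterval.nonneg'

theorem IsThompson.isDyadic {f : I ≃ₜ I} (h : IsThompson f) {t : I} (ht : IsDyadic t) :
    IsDyadic (f t) := by
  have h0 := h.map_zero
  obtain ⟨B, hB, h⟩ := h
  rcases eq_or_lt_of_le (unitInterval.nonneg' : 0 ≤ t) with rfl | hlt
  · rw [h0]; exact ht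
  · have := (h.key hB _ 0 t hlt rfl).2 ⟨0, 0, by simp⟩ ht
    rw [h0] at this
    simpa using this

theorem IsThompson.one : IsThompson 1 :=
  ⟨∅, by simp, fun _ _ _ _ => ⟨0, fun x _ y _ => by simp⟩⟩

theorem IsThompson.inv {f : I ≃ₜ I} (h : IsThompson f) : IsThompson f⁻¹ := by
  have hd := @IsThompson.isDyadic f h
  have hm := h.strictMono
  obtain ⟨B, hB, h⟩ := h
  have e : ∀ x, f (f⁻¹ x) = x := fun x => f.apply_symm_apply x
  refine ⟨B.image f, fun s hs => ?_, fun t u htu hno => ?_⟩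
  · obtain ⟨r, hr, rfl⟩ := Finset.mem_image.1 hs
    exact hd (hB r hr)
  · have l : ∀ {x y}, x ≤ y → f⁻¹ x ≤ f⁻¹ y := fun {x y} hxy => by
      rw [← hm.le_iff_le, e, e]; exact hxy
    obtain ⟨k, hk⟩ := h (f⁻¹ t) (f⁻¹ u) (by rw [← hm.lt_iff_lt, e, e]; exact htu)
      (fun s hs hst => hno (f s) (Finset.mem_image_of_mem f hs)
        ⟨by rw [← e t]; exact hm hst.1, by rw [← e u]; exact hm hst.2⟩)
    refine ⟨-k, fun x hx y hy => ?_⟩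
    have := hk (f⁻¹ x) ⟨l hx.1, l hx.2⟩ (f⁻¹ y) ⟨l hy.1, l hy.2⟩
    rw [e, e] at this
    rw [this, ← mul_assoc, ← zpow_add₀ (by norm_num)]
    simp

theorem IsThompson.mul {f g : I ≃ₜ I} (hf : IsThompson f) (hg : IsThompson g) :
    IsThompson (f * g) := by
  have hd := @IsThompson.isDyadic _ hg.inv
  have hm := hg.strictMono
  obtain ⟨B, hB, hf⟩ := hf
  obtain ⟨C, hC, hg⟩ := hg
  refine ⟨C ∪ B.image (g⁻¹ : I ≃ₜ I), fun s hs => ?_, fun t u htu hno => ?_⟩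
  · rcases Finset.mem_union.1 hs with hs | hs
    · exact hC s hs
    · obtain ⟨r, hr, rfl⟩ := Finset.mem_image.1 hs
      exact hd (hB r hr)
  · obtain ⟨k, hk⟩ := hg t u htu fun s hs => hno s (Finset.mem_union_left _ hs)
    obtain ⟨j, hj⟩ := hf (g t) (g u) (hm htu) fun s hs hst =>
      hno (g⁻¹ s) (Finset.mem_union_right _ (Finset.mem_image_of_mem _ hs)) (by
        have e' : g (g⁻¹ s) = s := g.apply_symm_apply s
        exact ⟨hm.lt_iff_lt.1 (by rw [e']; exact hst.1), hm.lt_iff_lt.1 (by rw [e']; exact hst.2)⟩)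
    refine ⟨j + k, fun x hx y hy => ?_⟩
    have h1 := hk x hx y hy
    have h2 := hj (g x) ⟨hm.monotone hx.1, hm.monotone hx.2⟩ (g y)
      ⟨hm.monotone hy.1, hm.monotone hy.2⟩
    rw [h1] at h2
    rw [zpow_add₀ (by norm_num), mul_assoc]
    exact h2

/-- Thompson's group `F`, as a group of homeomorphisms of `[0, 1]` (the product is composition). -/
def F : Subgroup (I ≃ₜ I) where
  carrier := {f | IsThompson f}
  mul_mem' := IsThompson.mul
  one_mem' := IsThompson.one
  inv_mem' := IsThompson.inv

/-- The dyadic numbers in `[0, 1]`. -/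
abbrev Dyadics : Type := {t : I // IsDyadic t}

/-- The natural action of `F` on the dyadic numbers in `[0, 1]`. -/
instance : MulAction F Dyadics where
  smul f t := ⟨f.1 t.1, IsThompson.isDyadic f.2 t.2⟩
  one_smul _ := rfl
  mul_smul _ _ _ := rfl

/-- The homeomorphism `t ↦ t/2` on `[0,1/2]`, `t - 1/4` on `[1/2,3/4]`, `2t - 1` on `[3/4,1]`. -/
noncomputable def aHomeo : I ≃ₜ I where
  toFun t := ⟨if (t : ℝ) ≤ 1 / 2 then t / 2 else if (t : ℝ) ≤ 3 / 4 then t - 1 / 4 else 2 * t - 1,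
    by have h0 := t.2.1; have h1 := t.2.2; split_ifs <;> constructor <;> linarith⟩
  invFun t := ⟨if (t : ℝ) ≤ 1 / 4 then 2 * t else if (t : ℝ) ≤ 1 / 2 then t + 1 / 4 else (t + 1) / 2,
    by have h0 := t.2.1; have h1 := t.2.2; split_ifs <;> constructor <;> linarith⟩
  left_inv t := by
    apply Subtype.ext
    dsimp only
    split_ifs <;> linarith
  right_inv t := by
    apply Subtype.ext
    dsimp only
    split_ifs <;> linarith
  continuous_toFun := by
    refine Continuous.subtype_mk (Continuous.if_le (by fun_prop) (Continuous.if_le (by fun_prop)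
      (by fun_prop) (by fun_prop) (by fun_prop) fun x hx => ?_) (by fun_prop) (by fun_prop)
      fun x hx => ?_) _
    · rw [hx]; norm_num
    · rw [hx]; norm_num
  continuous_invFun := by
    refine Continuous.subtype_mk (Continuous.if_le (by fun_prop) (Continuous.if_le (by fun_prop)
      (by fun_prop) (by fun_prop) (by fun_prop) fun x hx => ?_) (by fun_prop) (by fun_prop)
      fun x hx => ?_) _
    · rw [hx]; norm_num
    · rw [hx]; norm_num

/-- The homeomorphism that is the identity on `[0,1/2]` and `t ↦ t/2 + 1/4` on `[1/2,3/4]`,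
`t - 1/8` on `[3/4,7/8]`, `2t - 1` on `[7/8,1]`. -/
noncomputable def bHomeo : I ≃ₜ I where
  toFun t := ⟨if (t : ℝ) ≤ 1 / 2 then t else if (t : ℝ) ≤ 3 / 4 then t / 2 + 1 / 4 else
      if (t : ℝ) ≤ 7 / 8 then t - 1 / 8 else 2 * t - 1,
    by have h0 := t.2.1; have h1 := t.2.2; split_ifs <;> constructor <;> linarith⟩
  invFun t := ⟨if (t : ℝ) ≤ 1 / 2 then t else if (t : ℝ) ≤ 5 / 8 then 2 * t - 1 / 2 else
      if (t : ℝ) ≤ 3 / 4 then t + 1 / 8 else (t + 1) / 2,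
    by have h0 := t.2.1; have h1 := t.2.2; split_ifs <;> constructor <;> linarith⟩
  left_inv t := by
    apply Subtype.ext
    dsimp only
    split_ifs <;> linarith
  right_inv t := by
    apply Subtype.ext
    dsimp only
    split_ifs <;> linarith
  continuous_toFun := by
    refine Continuous.subtype_mk (Continuous.if_le (by fun_prop) (Continuous.if_le (by fun_prop)
      (Continuous.if_le (by fun_prop) (by fun_prop) (by fun_prop) (by fun_prop) fun x hx => ?_)
      (by fun_prop) (by fun_prop) fun x hx => ?_) (by fun_prop) (by fun_prop) fun x hx => ?_) _
    · rw [hx]; norm_num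
    · rw [hx]; norm_num
    · rw [hx]; norm_num
  continuous_invFun := by
    refine Continuous.subtype_mk (Continuous.if_le (by fun_prop) (Continuous.if_le (by fun_prop)
      (Continuous.if_le (by fun_prop) (by fun_prop) (by fun_prop) (by fun_prop) fun x hx => ?_)
      (by fun_prop) (by fun_prop) fun x hx => ?_) (by fun_prop) (by fun_prop) fun x hx => ?_) _
    · rw [hx]; norm_num
    · rw [hx]; norm_num
    · rw [hx]; norm_num

theorem isThompson_aHomeo : IsThompson aHomeo := by
  refine ⟨{⟨1 / 2, by norm_num, by norm_num⟩, ⟨3 / 4, by norm_num, by norm_num⟩}, ?_, ?_⟩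
  · simp only [Finset.mem_insert, Finset.mem_singleton, forall_eq_or_imp, forall_eq]
    exact ⟨⟨1, 1, by norm_num⟩, ⟨3, 2, by norm_num⟩⟩
  · intro t u _ h
    simp only [Finset.mem_insert, Finset.mem_singleton, forall_eq_or_imp, forall_eq,
      ← Subtype.coe_lt_coe, not_and, not_lt] at h
    obtain ⟨h1, h2⟩ := h
    rcases le_or_gt (u : ℝ) (1 / 2) with c1 | c1
    · refine ⟨-1, fun x hx y hy => ?_⟩
      have hx2 : (x : ℝ) ≤ u := hx.2
      have hy2 : (y : ℝ) ≤ u := hy.2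
      simp only [aHomeo, Homeomorph.homeomorph_mk_coe, Equiv.coe_fn_mk]
      split_ifs <;> norm_num <;> linarith
    have c1' : (1 / 2 : ℝ) ≤ t := not_lt.1 fun c => absurd c1 (not_lt.2 (h1 c))
    rcases le_or_gt (u : ℝ) (3 / 4) with c2 | c2
    · refine ⟨0, fun x hx y hy => ?_⟩
      have hx1 : (t : ℝ) ≤ x := hx.1
      have hy1 : (t : ℝ) ≤ y := hy.1
      have hx2 : (x : ℝ) ≤ u := hx.2
      have hy2 : (y : ℝ) ≤ u := hy.2
      simp only [aHomeo, Homeomorph.homeomorph_mk_coe, Equiv.coe_fn_mk]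
      split_ifs <;> norm_num <;> linarith
    have c2' : (3 / 4 : ℝ) ≤ t := not_lt.1 fun c => absurd c2 (not_lt.2 (h2 c))
    refine ⟨1, fun x hx y hy => ?_⟩
    have hx1 : (t : ℝ) ≤ x := hx.1
    have hy1 : (t : ℝ) ≤ y := hy.1
    simp only [aHomeo, Homeomorph.homeomorph_mk_coe, Equiv.coe_fn_mk]
    split_ifs <;> norm_num <;> linarith

theorem isThompson_bHomeo : IsThompson bHomeo := by
  refine ⟨{⟨1 / 2, by norm_num, by norm_num⟩, ⟨3 / 4, by norm_num, by norm_num⟩,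
    ⟨7 / 8, by norm_num, by norm_num⟩}, ?_, ?_⟩
  · simp only [Finset.mem_insert, Finset.mem_singleton, forall_eq_or_imp, forall_eq]
    exact ⟨⟨1, 1, by norm_num⟩, ⟨3, 2, by norm_num⟩, ⟨7, 3, by norm_num⟩⟩
  · intro t u _ h
    simp only [Finset.mem_insert, Finset.mem_singleton, forall_eq_or_imp, forall_eq,
      ← Subtype.coe_lt_coe, not_and, not_lt] at h
    obtain ⟨h1, h2, h3⟩ := h
    rcases le_or_gt (u : ℝ) (1 / 2) with c1 | c1
    · refine ⟨0, fun x hx y hy => ?_⟩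
      have hx2 : (x : ℝ) ≤ u := hx.2
      have hy2 : (y : ℝ) ≤ u := hy.2
      simp only [bHomeo, Homeomorph.homeomorph_mk_coe, Equiv.coe_fn_mk]
      split_ifs <;> norm_num <;> linarith
    have c1' : (1 / 2 : ℝ) ≤ t := not_lt.1 fun c => absurd c1 (not_lt.2 (h1 c))
    rcases le_or_gt (u : ℝ) (3 / 4) with c2 | c2
    · refine ⟨-1, fun x hx y hy => ?_⟩
      have hx1 : (t : ℝ) ≤ x := hx.1
      have hy1 : (t : ℝ) ≤ y := hy.1
      have hx2 : (x : ℝ) ≤ u := hx.2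
      have hy2 : (y : ℝ) ≤ u := hy.2
      simp only [bHomeo, Homeomorph.homeomorph_mk_coe, Equiv.coe_fn_mk]
      split_ifs <;> norm_num <;> linarith
    have c2' : (3 / 4 : ℝ) ≤ t := not_lt.1 fun c => absurd c2 (not_lt.2 (h2 c))
    rcases le_or_gt (u : ℝ) (7 / 8) with c3 | c3
    · refine ⟨0, fun x hx y hy => ?_⟩
      have hx1 : (t : ℝ) ≤ x := hx.1
      have hy1 : (t : ℝ) ≤ y := hy.1
      have hx2 : (x : ℝ) ≤ u := hx.2
      have hy2 : (y : ℝ) ≤ u := hy.2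
      simp only [bHomeo, Homeomorph.homeomorph_mk_coe, Equiv.coe_fn_mk]
      split_ifs <;> norm_num <;> linarith
    have c3' : (7 / 8 : ℝ) ≤ t := not_lt.1 fun c => absurd c3 (not_lt.2 (h3 c))
    refine ⟨1, fun x hx y hy => ?_⟩
    have hx1 : (t : ℝ) ≤ x := hx.1
    have hy1 : (t : ℝ) ≤ y := hy.1
    simp only [bHomeo, Homeomorph.homeomorph_mk_coe, Equiv.coe_fn_mk]
    split_ifs <;> norm_num <;> linarith

/-- The first standard generator of `F`. -/
noncomputable def a : F := ⟨aHomeo, isThompson_aHomeo⟩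

/-- The second standard generator of `F`. -/
noncomputable def b : F := ⟨bHomeo, isThompson_bHomeo⟩

/-- The standard generating set of `F`. -/
def gens : Set F := {a, b}

/-- The dyadic number `1/2`. -/
noncomputable def half : Dyadics := ⟨⟨1 / 2, by norm_num, by norm_num⟩, 1, 1, by norm_num⟩

/-- The vertices of `𝓗`: the orbit of `1/2`. -/
abbrev Vertex : Type := MulAction.orbit F half

/-- The base point `1/2`. -/
noncomputable def basePt : Vertex := ⟨half, MulAction.mem_orbit_self half⟩

/-- The Schreier graph `𝓗` of the action of `F` on the orbit of `1/2`. -/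
noncomputable def graphH : SimpleGraph Vertex := schreierGraph gens Vertex

/-- The real number represented by a vertex. -/
def Vertex.val (x : Vertex) : ℝ := ((x.1.1 : I) : ℝ)

/-- Black vertices: binary expansion `0.0…`. -/
def IsBlack (x : Vertex) : Prop := x.val < 1 / 2

/-- Grey vertices: binary expansion `0.10…`. -/
def IsGrey (x : Vertex) : Prop := 1 / 2 ≤ x.val ∧ x.val < 3 / 4

/-- White vertices: binary expansion `0.11…`. -/
def IsWhite (x : Vertex) : Prop := 3 / 4 ≤ x.val

/-- The vertices of the tree: the grey vertices other than `1/2`, and the white vertices adjacent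
to one of them. -/
def OnTree (x : Vertex) : Prop :=
  (IsGrey x ∧ x ≠ basePt) ∨ (IsWhite x ∧ ∃ y, IsGrey y ∧ y ≠ basePt ∧ graphH.Adj x y)

/-- The vertex `x` has type `i`. -/
def HasType (x : Vertex) : Fin 5 → Prop :=
  ![x = basePt,
    IsBlack x,
    IsGrey x ∧ x ≠ basePt,
    IsWhite x ∧ OnTree x,
    IsWhite x ∧ ¬ OnTree x]

/-- An element of `F` in the group ring. -/
noncomputable abbrev ofF (g : F) : MonoidAlgebra ℤ F := MonoidAlgebra.of ℤ F g

/-- The transition matrix with entries in the group ring. -/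
noncomputable def matrixAbold : Matrix (Fin 5) (Fin 5) (MonoidAlgebra ℤ F) :=
  !![0, ofF a, 0, ofF a⁻¹, 0;
     0, ofF a, 0, 0, 0;
     0, ofF a, ofF b, ofF a⁻¹, 0;
     0, 0, ofF b, 0, ofF a⁻¹ + ofF b⁻¹;
     0, 0, 0, 0, ofF a⁻¹ + ofF b⁻¹]

/-- The transition matrix for the numbers of geodesics. -/
noncomputable def matrixA : Matrix (Fin 5) (Fin 5) (PowerSeries ℝ) :=
  !![0, 1, 0, 1, 0;
     0, 1, 0, 0, 0;
     0, 1, 1, 1, 0;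
     0, 0, 1, 0, 2;
     0, 0, 0, 0, 2]

/-- The transition matrix for the numbers of end points of geodesics. -/
noncomputable def matrixB : Matrix (Fin 5) (Fin 5) (PowerSeries ℝ) :=
  !![0, 1, 0, 1, 0;
     0, 1, 0, 0, 0;
     0, 1, 1, 1, 0;
     0, 0, 1, 0, 1;
     0, 0, 0, 0, 1]

end Thompson

/-!
The map moving a dyadic number of `(0, 1)` one step towards `1/2` shows that, up to loops and double
edges, `𝓗` is a tree rooted at `1/2`. Hence `g` continues the geodesics ending at `x` if and only if
each letter of a shortest word for `g` leads away from `1/2`. Which letters do so, and to which of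
the five types of vertices they lead, depends only on the type of the vertex, so the cone types are
the states of a finite automaton.

Continuations of the same vertex with different first letters are different elements of `F`: in
a tree they have different end points unless both letters lead to the same vertex. This happens for
`a⁻¹` and `b⁻¹` at the white vertices only. There `h b⁻¹ ≠ g a⁻¹`, because `b⁻¹` fixes `1/2`,
whereas `a⁻¹` sends it to a white vertex, from which `g` leads further away: so `g a⁻¹` moves `1/2`
further than `h b⁻¹` can. Therefore geodesics are counted by the number of letters between two
types, and their end points by the number of vertices. Both counts satisfy a recurrence
`sₙ₊₁ = M sₙ`, which is the equation `(1 - z M) ∑ sₙ zⁿ = s₀` between power series.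
-/

section Words

open scoped Pointwise

variable {G : Type*} [Group G] {S : Set G} {u v : List G} {g h s : G} {n : ℕ}

theorem isWordFor_nil : IsWordFor S [] 1 := ⟨by simp, rfl⟩

theorem isWordFor_singleton (hs : s ∈ S ∪ S⁻¹) : IsWordFor S [s] s := ⟨by simpa using hs, by simp⟩

theorem isWordFor_append : IsWordFor S (u ++ v) g ↔
    (∀ s ∈ u, s ∈ S ∨ s⁻¹ ∈ S) ∧ (∀ s ∈ v, s ∈ S ∨ s⁻¹ ∈ S) ∧ u.prod * v.prod = g := by
  simp only [IsWordFor, List.forall_mem_append, List.prod_append, and_assoc]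

theorem IsWordFor.append (hu : IsWordFor S u g) (hv : IsWordFor S v h) :
    IsWordFor S (u ++ v) (g * h) :=
  isWordFor_append.2 ⟨hu.1, hv.1, by rw [hu.2, hv.2]⟩

theorem IsWordFor.wordLength_le (hu : IsWordFor S u g) : wordLength S g ≤ u.length :=
  iInf₂_le u hu

theorem exists_isWordFor_of_wordLength_eq (hg : wordLength S g = n) :
    ∃ u, IsWordFor S u g ∧ u.length = n := by
  have hne : Nonempty {u // IsWordFor S u g} := by
    by_contra! hempty
    rw [wordLength, iInf_subtype', iInf_of_empty] at hg
    exact ENat.top_ne_natCast n hg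
  rw [wordLength, iInf_subtype'] at hg
  obtain ⟨u, hu⟩ := ENat.exists_eq_iInf fun u : {u // IsWordFor S u g} => (u.1.length : ℕ∞)
  exact ⟨u, u.2, by exact_mod_cast hu.trans hg⟩

theorem wordLength_le_one (hs : s ∈ S ∪ S⁻¹) : wordLength S s ≤ 1 := by
  simpa using (isWordFor_singleton hs).wordLength_le

theorem exists_wordLength_eq_of_le (hg : wordLength S g ≤ n) : ∃ m ≤ n, wordLength S g = m := by
  obtain ⟨m, hm⟩ := ENat.ne_top_iff_exists.1 (ne_top_of_le_ne_top (ENat.natCast_ne_top n) hg)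
  exact ⟨m, by exact_mod_cast hm ▸ hg, hm.symm⟩

theorem wordLength_mul_le (g h : G) : wordLength S (g * h) ≤ wordLength S g + wordLength S h := by
  rcases eq_or_ne (wordLength S g) ⊤ with hg | hg
  · simp [hg]
  rcases eq_or_ne (wordLength S h) ⊤ with hh | hh
  · simp [hh]
  obtain ⟨m, hm⟩ := ENat.ne_top_iff_exists.1 hg
  obtain ⟨k, hk⟩ := ENat.ne_top_iff_exists.1 hh
  obtain ⟨u, hu, hum⟩ := exists_isWordFor_of_wordLength_eq hm.symm
  obtain ⟨v, hv, hvk⟩ := exists_isWordFor_of_wordLength_eq hk.symm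
  calc wordLength S (g * h) ≤ (u ++ v).length := (hu.append hv).wordLength_le
    _ = wordLength S g + wordLength S h := by simp [hum, hvk, ← hm, ← hk]

theorem exists_mul_eq_of_wordLength_eq_succ (hg : wordLength S g = (n + 1 : ℕ)) :
    ∃ h, wordLength S h ≤ n ∧ ∃ s ∈ S ∪ S⁻¹, h * s = g := by
  obtain ⟨u, hu, hun⟩ := exists_isWordFor_of_wordLength_eq hg
  obtain ⟨v, s, rfl⟩ : ∃ v s, u = v ++ [s] :=
    u.eq_nil_or_concat'.resolve_left (List.ne_nil_of_length_eq_add_one hun)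
  obtain ⟨hv, hs, hvs⟩ := isWordFor_append.1 hu
  refine ⟨v.prod, ?_, s, by simpa using hs, by simpa using hvs⟩
  have hvn : v.length = n := by simpa using hun
  exact hvn ▸ IsWordFor.wordLength_le ⟨hv, rfl⟩

end Words

theorem edist_eq_natCast_iff_dist_eq {V : Type*} {H : SimpleGraph V} (hH : H.Connected) {x y : V}
    {n : ℕ} : H.edist x y = n ↔ H.dist x y = n := by
  rw [← (hH x y).coe_dist_eq_edist, Nat.cast_inj]

section SchreierDistance

open scoped Pointwise

variable {G X : Type*} [Group G] [MulAction G X] {S : Set G} {p x y : X} {g s : G} {n : ℕ}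

theorem schreierGraph_adj :
    (schreierGraph S X).Adj x y ↔ x ≠ y ∧ ∃ s ∈ S ∪ S⁻¹, s • x = y := by
  rw [schreierGraph, SimpleGraph.fromRel_adj]
  refine and_congr_right fun _ => ⟨?_, ?_⟩
  · rintro (⟨s, hs, rfl⟩ | ⟨s, hs, rfl⟩)
    · exact ⟨s, Or.inl hs, rfl⟩
    · exact ⟨s⁻¹, Or.inr (Set.inv_mem_inv.2 hs), inv_smul_smul s y⟩
  · rintro ⟨s, hs | hs, rfl⟩
    · exact Or.inl ⟨s, hs, rfl⟩
    · exact Or.inr ⟨s⁻¹, hs, inv_smul_smul s x⟩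

theorem schreierGraph_edist_list_prod_smul_le (u : List G) (hu : ∀ s ∈ u, s ∈ S ∪ S⁻¹) (x : X) :
    (schreierGraph S X).edist x (u.prod • x) ≤ u.length := by
  induction u with
  | nil => simp
  | cons s u ih =>
    obtain ⟨hs, hu⟩ := List.forall_mem_cons.1 hu
    have hstep : (schreierGraph S X).edist (u.prod • x) (s • u.prod • x) ≤ 1 := by
      rw [SimpleGraph.edist_le_one_iff_adj_or_eq, schreierGraph_adj]
      by_cases heq : u.prod • x = s • u.prod • x
      · exact Or.inr heq
      · exact Or.inl ⟨heq, s, hs, rfl⟩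
    calc (schreierGraph S X).edist x ((s :: u).prod • x)
        = (schreierGraph S X).edist x (s • u.prod • x) := by rw [List.prod_cons, mul_smul]
      _ ≤ u.length + 1 := SimpleGraph.edist_triangle.trans (add_le_add (ih hu) hstep)
      _ = (s :: u).length := by simp

theorem schreierGraph_edist_smul_le_wordLength (g : G) (x : X) :
    (schreierGraph S X).edist x (g • x) ≤ wordLength S g :=
  le_iInf₂ fun u hu => hu.2 ▸ schreierGraph_edist_list_prod_smul_le u hu.1 x

theorem exists_smul_eq_of_walk (w : (schreierGraph S X).Walk x y) :
    ∃ g, wordLength S g ≤ w.length ∧ g • x = y := by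
  induction w with
  | nil => exact ⟨1, by simpa using (isWordFor_nil (S := S)).wordLength_le, one_smul G _⟩
  | cons hadj w ih =>
    obtain ⟨-, s, hs, rfl⟩ := schreierGraph_adj.1 hadj
    obtain ⟨g, hg, rfl⟩ := ih
    refine ⟨g * s, ?_, mul_smul g s _⟩
    rw [SimpleGraph.Walk.length_cons, Nat.cast_succ]
    exact (wordLength_mul_le g s).trans (add_le_add hg (wordLength_le_one hs))

theorem exists_wordLength_eq_of_edist_eq (hxy : (schreierGraph S X).edist x y = n) :
    ∃ g, wordLength S g = n ∧ g • x = y := by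
  obtain ⟨w, hw⟩ := SimpleGraph.exists_walk_of_edist_eq_coe hxy
  obtain ⟨g, hg, rfl⟩ := exists_smul_eq_of_walk w
  exact ⟨g, le_antisymm (hw ▸ hg) (hxy ▸ schreierGraph_edist_smul_le_wordLength g x), rfl⟩

theorem graphSphere_schreierGraph : graphSphere (schreierGraph S X) p n =
    {x | ∃ g, IsGeodesicOfLength S p g n ∧ g • p = x} := by
  ext x
  refine ⟨fun hx => ?_, ?_⟩
  · obtain ⟨g, hg, rfl⟩ := exists_wordLength_eq_of_edist_eq hx
    exact ⟨g, ⟨hg, hx⟩, rfl⟩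
  · rintro ⟨g, hg, rfl⟩
    exact hg.2

section Connected

variable (hc : (schreierGraph S X).Connected)

include hc

theorem schreierGraph_dist_smul_le (hg : wordLength S g ≤ n) :
    (schreierGraph S X).dist p (g • x) ≤ (schreierGraph S X).dist p x + n := by
  have hx : (schreierGraph S X).edist x (g • x) ≤ n :=
    (schreierGraph_edist_smul_le_wordLength g x).trans hg
  rw [← (hc x (g • x)).coe_dist_eq_edist, Nat.cast_le] at hx
  exact hc.dist_triangle.trans (Nat.add_le_add_left hx _)

theorem schreierGraph_dist_smul_le_succ (hs : s ∈ S ∪ S⁻¹) :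
    (schreierGraph S X).dist p (s • x) ≤ (schreierGraph S X).dist p x + 1 :=
  schreierGraph_dist_smul_le hc (wordLength_le_one hs)

theorem isGeodesicOfLength_iff_dist : IsGeodesicOfLength S p g n ↔
    wordLength S g = n ∧ (schreierGraph S X).dist p (g • p) = n := by
  rw [IsGeodesicOfLength, edist_eq_natCast_iff_dist_eq hc]

theorem exists_isGeodesicOfLength (p x : X) :
    ∃ w, IsGeodesicOfLength S p w ((schreierGraph S X).dist p x) ∧ w • p = x := by
  obtain ⟨w, hw, rfl⟩ :=
    exists_wordLength_eq_of_edist_eq ((edist_eq_natCast_iff_dist_eq hc (x := p) (y := x)).2 rfl)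
  exact ⟨w, (isGeodesicOfLength_iff_dist hc).2 ⟨hw, rfl⟩, rfl⟩

end Connected

end SchreierDistance

section Cones

open scoped Pointwise

variable {G X : Type*} [Group G] [MulAction G X] {S : Set G} {p x y : X} {g h s : G} {n : ℕ}

theorem coneLevel_congr (hxy : coneType S p x = coneType S p y) :
    coneLevel S p x n = coneLevel S p y n := by
  rw [coneLevel, coneLevel, hxy]

variable (hc : (schreierGraph S X).Connected)

include hc

theorem mem_coneType_iff : g ∈ coneType S p x ↔ ∃ n : ℕ, wordLength S g = n ∧
    (schreierGraph S X).dist p (g • x) = (schreierGraph S X).dist p x + n := by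
  refine ⟨fun hg => ?_, ?_⟩
  · obtain ⟨w, hw, hwx⟩ := exists_isGeodesicOfLength hc p x
    obtain ⟨n, hgn, hgw⟩ := hg w _ hw hwx
    rw [isGeodesicOfLength_iff_dist hc, mul_smul, hwx, add_comm] at hgw
    exact ⟨n, hgn, hgw.2⟩
  · rintro ⟨n, hgn, hdist⟩ w m hw rfl
    rw [isGeodesicOfLength_iff_dist hc] at hw
    rw [hw.2, ← mul_smul, add_comm, ← edist_eq_natCast_iff_dist_eq hc] at hdist
    refine ⟨n, hgn, le_antisymm ?_ (hdist ▸ schreierGraph_edist_smul_le_wordLength _ p), hdist⟩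
    calc wordLength S (g * w) ≤ wordLength S g + wordLength S w := wordLength_mul_le g w
      _ = (n + m : ℕ) := by rw [hgn, hw.1, Nat.cast_add]

theorem mem_coneLevel_iff : g ∈ coneLevel S p x n ↔ wordLength S g = n ∧
    (schreierGraph S X).dist p (g • x) = (schreierGraph S X).dist p x + n := by
  rw [coneLevel, Set.mem_ofPred_eq, mem_coneType_iff hc]
  refine ⟨?_, fun hg => ⟨⟨n, hg⟩, hg.1⟩⟩
  rintro ⟨⟨m, hm, hdist⟩, hn⟩
  obtain rfl : m = n := by exact_mod_cast hm.symm.trans hn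
  exact ⟨hm, hdist⟩

theorem mem_coneLevel_of_le (hg : wordLength S g ≤ n)
    (hdist : (schreierGraph S X).dist p x + n ≤ (schreierGraph S X).dist p (g • x)) :
    g ∈ coneLevel S p x n := by
  obtain ⟨m, hmn, hm⟩ := exists_wordLength_eq_of_le hg
  have hdist' := schreierGraph_dist_smul_le (p := p) (x := x) hc hm.le
  obtain rfl : m = n := by omega
  exact (mem_coneLevel_iff hc).2 ⟨hm, by omega⟩

theorem mem_coneLevel_one_iff : s ∈ coneLevel S p x 1 ↔
    s ∈ S ∪ S⁻¹ ∧ (schreierGraph S X).dist p (s • x) = (schreierGraph S X).dist p x + 1 := by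
  refine ⟨fun hs => ?_, fun hs => mem_coneLevel_of_le hc (wordLength_le_one hs.1) hs.2.ge⟩
  obtain ⟨hlen, hdist⟩ := (mem_coneLevel_iff hc).1 hs
  obtain ⟨u, hu, hu1⟩ := exists_isWordFor_of_wordLength_eq hlen
  obtain ⟨t, rfl⟩ := List.length_eq_one_iff.1 hu1
  obtain rfl : t = s := by simpa using hu.2
  exact ⟨hu.1 t (List.mem_singleton_self t), hdist⟩

theorem coneLevel_zero : coneLevel S p x 0 = {1} := by
  ext g
  refine ⟨fun hg => ?_, ?_⟩
  · obtain ⟨u, hu, hu0⟩ := exists_isWordFor_of_wordLength_eq ((mem_coneLevel_iff hc).1 hg).1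
    rw [List.length_eq_zero_iff.1 hu0] at hu
    exact hu.2.symm
  · rintro rfl
    exact mem_coneLevel_of_le hc (by simpa using (isWordFor_nil (S := S)).wordLength_le) (by simp)

theorem coneLevel_basepoint : coneLevel S p p n = {g | IsGeodesicOfLength S p g n} := by
  ext g
  rw [mem_coneLevel_iff hc, Set.mem_ofPred_eq, isGeodesicOfLength_iff_dist hc,
    SimpleGraph.dist_self, zero_add]

theorem mul_mem_coneLevel_succ_iff (hg : wordLength S g ≤ n) (hs : s ∈ S ∪ S⁻¹) :
    g * s ∈ coneLevel S p x (n + 1) ↔ s ∈ coneLevel S p x 1 ∧ g ∈ coneLevel S p (s • x) n := by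
  have hsx := schreierGraph_dist_smul_le_succ (p := p) (x := x) hc hs
  have hgx := schreierGraph_dist_smul_le (p := p) (x := s • x) hc hg
  refine ⟨fun hgs => ?_, fun ⟨hs1, hgn⟩ => ?_⟩
  · have hgs := ((mem_coneLevel_iff hc).1 hgs).2
    rw [mul_smul] at hgs
    exact ⟨(mem_coneLevel_one_iff hc).2 ⟨hs, by omega⟩, mem_coneLevel_of_le hc hg (by omega)⟩
  · refine mem_coneLevel_of_le hc ?_ ?_
    · exact (wordLength_mul_le g s).trans (add_le_add hg (wordLength_le_one hs))
    · rw [mul_smul, ((mem_coneLevel_iff hc).1 hgn).2, ((mem_coneLevel_one_iff hc).1 hs1).2]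
      omega

theorem coneLevel_succ : coneLevel S p x (n + 1) =
    ⋃ s ∈ coneLevel S p x 1, (· * s) '' coneLevel S p (s • x) n := by
  ext g
  simp only [Set.mem_iUnion, Set.mem_image, exists_prop]
  constructor
  · intro hg
    obtain ⟨h, hh, s, hs, rfl⟩ :=
      exists_mul_eq_of_wordLength_eq_succ ((mem_coneLevel_iff hc).1 hg).1
    obtain ⟨hs1, hhn⟩ := (mul_mem_coneLevel_succ_iff hc hh hs).1 hg
    exact ⟨s, hs1, h, hhn, rfl⟩
  · rintro ⟨s, hs, h, hh, rfl⟩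
    exact (mul_mem_coneLevel_succ_iff hc ((mem_coneLevel_iff hc).1 hh).1.le
      ((mem_coneLevel_one_iff hc).1 hs).1).2 ⟨hs, hh⟩

theorem finite_coneLevel (hS : S.Finite) (x : X) (n : ℕ) : (coneLevel S p x n).Finite := by
  induction n generalizing x with
  | zero => simp [coneLevel_zero hc]
  | succ n ih =>
    have hone : (coneLevel S p x 1).Finite :=
      (hS.union hS.inv).subset fun s hs => ((mem_coneLevel_one_iff hc).1 hs).1
    rw [coneLevel_succ hc]
    exact hone.biUnion fun s _ => (ih (s • x)).image _

theorem coneType_eq_iff_coneLevel_eq :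
    coneType S p x = coneType S p y ↔ ∀ n, coneLevel S p x n = coneLevel S p y n := by
  have hmem (z : X) (g : G) : g ∈ coneType S p z ↔ ∃ n, g ∈ coneLevel S p z n := by
    simp only [mem_coneType_iff hc, mem_coneLevel_iff hc]
  refine ⟨fun hxy n => coneLevel_congr hxy, fun hxy => ?_⟩
  ext g
  simp only [hmem, hxy]

theorem coneLevel_subset_of_simulation {r : X → X → Prop}
    (hr : ∀ x y, r x y → ∀ s ∈ coneLevel S p x 1, s ∈ coneLevel S p y 1 ∧ r (s • x) (s • y))
    (hxy : r x y) : coneLevel S p x n ⊆ coneLevel S p y n := by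
  induction n generalizing x y with
  | zero => rw [coneLevel_zero hc, coneLevel_zero hc]
  | succ n ih =>
    rw [coneLevel_succ hc, coneLevel_succ (x := y) (n := n) hc]
    refine Set.iUnion₂_subset fun s hs => ?_
    obtain ⟨hsy, hr'⟩ := hr x y hxy s hs
    exact (Set.image_mono (ih hr')).trans
      (Set.subset_iUnion₂ (s := fun s _ => (· * s) '' coneLevel S p (s • y) n) s hsy)

end Cones

section Spelling

variable {G X : Type*} [Group G] [MulAction G X] {S : Set G} {p x : X} {g : G} {n : ℕ}

/-- Geodesic continuations of the same vertex that start with different letters are different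
elements of the group: for all `x` and `n` the union in `coneLevel_succ` is disjoint. -/
def HasDisjointBranches (S : Set G) (p : X) : Prop :=
  ∀ (x : X) (n : ℕ),
    (coneLevel S p x 1).PairwiseDisjoint fun s => (· * s) '' coneLevel S p (s • x) n

theorem HasDisjointBranches.existsUnique_isWordFor (hd : HasDisjointBranches S p)
    (hc : (schreierGraph S X).Connected) (hg : g ∈ coneLevel S p x n) :
    ∃! u, IsWordFor S u g ∧ u.length = n := by
  obtain ⟨hlen, -⟩ := (mem_coneLevel_iff hc).1 hg
  refine existsUnique_of_exists_of_unique (exists_isWordFor_of_wordLength_eq hlen) ?_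
  rintro u v ⟨hu, hun⟩ ⟨hv, hvn⟩
  clear hlen
  induction n generalizing x g u v with
  | zero => rw [List.length_eq_zero_iff.1 hun, List.length_eq_zero_iff.1 hvn]
  | succ n ih =>
    have hsplit (w : List G) (hw : IsWordFor S w g) (hwn : w.length = n + 1) :
        ∃ w' s, w = w' ++ [s] ∧ s ∈ coneLevel S p x 1 ∧ w'.prod ∈ coneLevel S p (s • x) n ∧
          IsWordFor S w' w'.prod ∧ w'.length = n ∧ w'.prod * s = g := by
      obtain ⟨w', s, rfl⟩ : ∃ w' s, w = w' ++ [s] :=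
        w.eq_nil_or_concat'.resolve_left (List.ne_nil_of_length_eq_add_one hwn)
      obtain ⟨hw', hs, rfl⟩ := isWordFor_append.1 hw
      have hwn' : w'.length = n := by simpa using hwn
      have hlast : w'.prod ∈ coneLevel S p (s • x) n ∧ s ∈ coneLevel S p x 1 := by
        rw [and_comm, ← mul_mem_coneLevel_succ_iff hc ?_ (by simpa using hs)]
        · simpa using hg
        · exact hwn' ▸ IsWordFor.wordLength_le ⟨hw', rfl⟩
      exact ⟨w', s, rfl, hlast.2, hlast.1, ⟨hw', rfl⟩, hwn', by simp⟩
    obtain ⟨u', s, rfl, hs, hu's, hu', hun', hug⟩ := hsplit u hu hun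
    obtain ⟨v', t, rfl, ht, hv't, hv', hvn', hvg⟩ := hsplit v hv hvn
    obtain rfl : s = t := (hd x n).elim_set hs ht g ⟨_, hu's, hug⟩ ⟨_, hv't, hvg⟩
    have hprod : v'.prod = u'.prod := mul_right_cancel (hvg.trans hug.symm)
    rw [ih hu's _ _ hu' hun' (hprod ▸ hv') hvn']

end Spelling

section Growth

variable {G X : Type*} [Group G] [MulAction G X] {S : Set G} {p x : X} {n : ℕ}

theorem HasDisjointBranches.coneSum_succ (hd : HasDisjointBranches S p)
    (hc : (schreierGraph S X).Connected) (hS : S.Finite) :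
    coneSum S p x (n + 1) =
      ∑ᶠ s ∈ coneLevel S p x 1, coneSum S p (s • x) n * MonoidAlgebra.of ℤ G s := by
  rw [coneSum, coneLevel_succ hc, finsum_mem_biUnion (hd x n) (finite_coneLevel hc hS x 1)
    fun s _ => (finite_coneLevel hc hS (s • x) n).image _]
  refine finsum_mem_congr rfl fun s _ => ?_
  rw [finsum_mem_image (mul_left_injective s).injOn]
  simp only [map_mul]
  exact (finsum_mem_mul' _ _ (finite_coneLevel hc hS (s • x) n)).symm

theorem HasDisjointBranches.ncard_coneLevel_succ (hd : HasDisjointBranches S p)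
    (hc : (schreierGraph S X).Connected) (hS : S.Finite) :
    (coneLevel S p x (n + 1)).ncard =
      ∑ᶠ s ∈ coneLevel S p x 1, (coneLevel S p (s • x) n).ncard := by
  rw [coneLevel_succ hc, Set.Finite.ncard_biUnion (finite_coneLevel hc hS x 1)
    (fun s _ => (finite_coneLevel hc hS (s • x) n).image _) (hd x n)]
  exact finsum_mem_congr rfl fun s _ => Set.ncard_image_of_injective _ (mul_left_injective s)

theorem coneSum_zero (hc : (schreierGraph S X).Connected) : coneSum S p x 0 = 1 := by
  rw [coneSum, coneLevel_zero hc, finsum_mem_singleton, map_one]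

theorem completeGeodesicGrowth_eq_mk_coneSum (hc : (schreierGraph S X).Connected) :
    completeGeodesicGrowth S p = PowerSeries.mk (coneSum S p p) := by
  ext1 n
  simp only [completeGeodesicGrowth, PowerSeries.coeff_mk, coneSum, coneLevel_basepoint hc]

theorem geodesicGrowth_eq_mk_ncard_coneLevel (hc : (schreierGraph S X).Connected) :
    geodesicGrowth S p = PowerSeries.mk fun n => ((coneLevel S p p n).ncard : ℝ) := by
  simp only [geodesicGrowth, coneLevel_basepoint hc]

/-- The end points of the geodesic continuations of length `n` from `x`; their number is
`coneOrbitCount`. -/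
def coneEndpoints (S : Set G) (p x : X) (n : ℕ) : Set X := (· • x) '' coneLevel S p x n

theorem coneEndpoints_zero (hc : (schreierGraph S X).Connected) : coneEndpoints S p x 0 = {x} := by
  rw [coneEndpoints, coneLevel_zero hc, Set.image_singleton, one_smul]

theorem coneEndpoints_succ (hc : (schreierGraph S X).Connected) :
    coneEndpoints S p x (n + 1) = ⋃ y ∈ coneEndpoints S p x 1, coneEndpoints S p y n := by
  rw [coneEndpoints, coneLevel_succ hc]
  simp only [coneEndpoints, Set.image_iUnion₂, Set.image_image, mul_smul, Set.biUnion_image]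

theorem finite_coneEndpoints (hc : (schreierGraph S X).Connected) (hS : S.Finite) :
    (coneEndpoints S p x n).Finite :=
  (finite_coneLevel hc hS x n).image _

theorem coneOrbitCount_eq_ncard_coneEndpoints :
    coneOrbitCount S p x n = (coneEndpoints S p x n).ncard := rfl

theorem coneOrbitCount_zero (hc : (schreierGraph S X).Connected) : coneOrbitCount S p x 0 = 1 := by
  rw [coneOrbitCount_eq_ncard_coneEndpoints, coneEndpoints_zero hc, Set.ncard_singleton]

theorem graphSphere_eq_coneEndpoints (hc : (schreierGraph S X).Connected) :
    graphSphere (schreierGraph S X) p n = coneEndpoints S p p n := by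
  rw [graphSphere_schreierGraph, coneEndpoints, coneLevel_basepoint hc]
  rfl

theorem orbitGrowth_eq_mk_ncard_graphSphere :
    orbitGrowth S p =
      PowerSeries.mk fun n => ((graphSphere (schreierGraph S X) p n).ncard : ℝ) := by
  simp only [orbitGrowth, graphSphere_schreierGraph]

theorem ncard_graphBall {V : Type*} {H : SimpleGraph V} {p : V}
    (hH : ∀ n, (graphSphere H p n).Finite) (n : ℕ) :
    (graphBall H p n).ncard = ∑ k ∈ Finset.range (n + 1), (graphSphere H p k).ncard := by
  have hball : graphBall H p n = ⋃ k ∈ Finset.range (n + 1), graphSphere H p k := by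
    ext y
    simp only [graphBall, graphSphere, Set.mem_ofPred_eq, Set.mem_iUnion, Finset.mem_range,
      exists_prop, Nat.lt_succ_iff]
    refine ⟨fun hy => ?_, ?_⟩
    · obtain ⟨k, hk⟩ := ENat.ne_top_iff_exists.1 (ne_top_of_le_ne_top (ENat.natCast_ne_top n) hy)
      exact ⟨k, by exact_mod_cast hk ▸ hy, hk.symm⟩
    · rintro ⟨k, hk, hy⟩
      exact hy ▸ Nat.cast_le.2 hk
  have hdisj : ((Finset.range (n + 1) : Finset ℕ) : Set ℕ).PairwiseDisjoint (graphSphere H p) :=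
    fun k _ l _ hkl => Set.disjoint_left.2 fun y hk hl =>
      hkl (Nat.cast_injective (hk.symm.trans hl))
  rw [hball]
  exact (Set.Finite.ncard_biUnion (Finset.finite_toSet _) (fun k _ => hH k) hdisj).trans
    (finsum_mem_coe_finset _ _)

end Growth

section ConeAutomaton

variable {G X ι : Type*} [Group G] [MulAction G X] {S : Set G} {p x y : X} {n : ℕ}

/-- A description of the cone types by the states of a finite automaton: `τ x` is the state of the
vertex `x`, and `E i j` is the set of letters by which geodesics are continued from a vertex in
state `i` to a vertex in state `j`. -/
def IsConeAutomaton (S : Set G) (p : X) (τ : X → ι) (E : ι → ι → Finset G) : Prop :=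
  ∀ x j s, s ∈ E (τ x) j ↔ s ∈ coneLevel S p x 1 ∧ τ (s • x) = j

namespace IsConeAutomaton

variable {τ : X → ι} {E : ι → ι → Finset G}

theorem coneLevel_eq (hE : IsConeAutomaton S p τ E) (hc : (schreierGraph S X).Connected)
    (hxy : τ x = τ y) (n : ℕ) : coneLevel S p x n = coneLevel S p y n := by
  have hsim (x y : X) (hxy : τ x = τ y) (s : G) (hs : s ∈ coneLevel S p x 1) :
      s ∈ coneLevel S p y 1 ∧ τ (s • x) = τ (s • y) := by
    have hsE : s ∈ E (τ y) (τ (s • x)) := hxy ▸ (hE x _ s).2 ⟨hs, rfl⟩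
    exact ((hE y _ s).1 hsE).imp_right Eq.symm
  exact (coneLevel_subset_of_simulation hc (r := fun x y => τ x = τ y) hsim hxy).antisymm
    (coneLevel_subset_of_simulation hc (r := fun x y => τ x = τ y) hsim hxy.symm)

theorem coneSum_eq (hE : IsConeAutomaton S p τ E) (hc : (schreierGraph S X).Connected)
    (hxy : τ x = τ y) (n : ℕ) : coneSum S p x n = coneSum S p y n := by
  rw [coneSum, coneSum, hE.coneLevel_eq hc hxy]

theorem state_eq_of_mem_image (hE : IsConeAutomaton S p τ E) {j : ι}
    (hy : y ∈ (· • x) '' (E (τ x) j : Set G)) : τ y = j := by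
  obtain ⟨s, hs, rfl⟩ := hy
  exact ((hE x j s).1 hs).2

theorem coneEndpoints_one (hE : IsConeAutomaton S p τ E) :
    coneEndpoints S p x 1 = ⋃ j, (· • x) '' (E (τ x) j : Set G) := by
  ext y
  simp only [coneEndpoints, Set.mem_iUnion, Set.mem_image, Finset.mem_coe, hE x]
  exact ⟨fun ⟨s, hs, hy⟩ => ⟨_, s, ⟨hs, rfl⟩, hy⟩, fun ⟨_, s, ⟨hs, _⟩, hy⟩ => ⟨s, hs, hy⟩⟩

variable [Fintype ι]

theorem finsum_mem_coneLevel_one (hE : IsConeAutomaton S p τ E) {M : Type*} [AddCommMonoid M]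
    (f : G → M) : ∑ᶠ s ∈ coneLevel S p x 1, f s = ∑ j, ∑ s ∈ E (τ x) j, f s := by
  have hunion : coneLevel S p x 1 = ⋃ j, (E (τ x) j : Set G) := by
    ext s
    simp only [Set.mem_iUnion, Finset.mem_coe, hE x, exists_and_left, exists_eq', and_true]
  have hdisj : Pairwise fun j k => Disjoint (E (τ x) j : Set G) (E (τ x) k) :=
    fun j k hjk => Set.disjoint_left.2 fun s hj hk =>
      hjk (((hE x j s).1 hj).2.symm.trans ((hE x k s).1 hk).2)
  rw [hunion, finsum_mem_iUnion hdisj fun j => (E (τ x) j).finite_toSet,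
    finsum_eq_sum_of_fintype]
  exact Finset.sum_congr rfl fun j _ => finsum_mem_coe_finset f _

variable {v : ι → X}

theorem coneSum_succ (hE : IsConeAutomaton S p τ E) (hd : HasDisjointBranches S p)
    (hc : (schreierGraph S X).Connected) (hS : S.Finite) (hv : ∀ j, τ (v j) = j) :
    coneSum S p x (n + 1) =
      ∑ j, coneSum S p (v j) n * ∑ s ∈ E (τ x) j, MonoidAlgebra.of ℤ G s := by
  rw [hd.coneSum_succ hc hS, hE.finsum_mem_coneLevel_one]
  refine Finset.sum_congr rfl fun j _ => ?_
  rw [Finset.mul_sum]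
  refine Finset.sum_congr rfl fun s hs => ?_
  rw [hE.coneSum_eq hc (((hE x j s).1 hs).2.trans (hv j).symm)]

theorem ncard_coneLevel_succ (hE : IsConeAutomaton S p τ E) (hd : HasDisjointBranches S p)
    (hc : (schreierGraph S X).Connected) (hS : S.Finite) (hv : ∀ j, τ (v j) = j) :
    (coneLevel S p x (n + 1)).ncard = ∑ j, (E (τ x) j).card * (coneLevel S p (v j) n).ncard := by
  rw [hd.ncard_coneLevel_succ hc hS, hE.finsum_mem_coneLevel_one]
  refine Finset.sum_congr rfl fun j _ => Finset.sum_const_nat fun s hs => ?_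
  rw [hE.coneLevel_eq hc (((hE x j s).1 hs).2.trans (hv j).symm)]

end IsConeAutomaton

end ConeAutomaton

section RootedTree

variable {V : Type*} {H : SimpleGraph V} {p x y : V} {π : V → V}

theorem exists_adj_dist_eq_succ (hH : H.Connected) (hx : x ≠ p) :
    ∃ y, H.Adj x y ∧ H.dist p x = H.dist p y + 1 := by
  obtain ⟨w, hw⟩ := hH.exists_walk_length_eq_dist x p
  cases w with
  | nil => exact absurd rfl hx
  | @cons _ y _ hadj w =>
    refine ⟨y, hadj, ?_⟩
    have hle : H.dist p x ≤ H.dist p y + H.dist y x := hH.dist_triangle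
    rw [SimpleGraph.dist_eq_one_iff_adj.2 hadj.symm] at hle
    have hge : H.dist y p ≤ w.length := SimpleGraph.dist_le w
    rw [SimpleGraph.Walk.length_cons] at hw
    rw [SimpleGraph.dist_comm (u := p), SimpleGraph.dist_comm (u := p)] at hle ⊢
    omega

/-- `π` sends every vertex of the graph `H` towards the root `p`, and every edge of `H` joins a
vertex to its image under `π`. Hence `H` is a tree, and `π x` is the parent of `x ≠ p`; the root
is, by convention, its own parent. -/
structure IsParentMap (H : SimpleGraph V) (p : V) (π : V → V) : Prop where
  map_root : π p = p
  exists_iterate_eq_root : ∀ x, ∃ k, π^[k] x = p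
  adj_iff : ∀ {x y}, H.Adj x y ↔ x ≠ y ∧ (π x = y ∨ π y = x)

namespace IsParentMap

theorem connected (hπ : IsParentMap H p π) : H.Connected := by
  have hstep (x : V) : H.Reachable x (π x) := by
    by_cases hx : x = π x
    · rw [← hx]
    · exact (hπ.adj_iff.2 ⟨hx, Or.inl rfl⟩).reachable
  have hiter (k : ℕ) (x : V) : H.Reachable x (π^[k] x) := by
    induction k with
    | zero => rfl
    | succ k ih => exact Function.iterate_succ_apply' π k x ▸ ih.trans (hstep _)
  have hroot (x : V) : H.Reachable x p := by
    obtain ⟨k, hk⟩ := hπ.exists_iterate_eq_root x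
    exact hk ▸ hiter k x
  have : Nonempty V := ⟨p⟩
  exact ⟨fun x y => (hroot x).trans (hroot y).symm⟩

theorem dist_eq_dist_map_add_one (hπ : IsParentMap H p π) (hx : x ≠ p) :
    H.dist p x = H.dist p (π x) + 1 := by
  induction hn : H.dist p x using Nat.strong_induction_on generalizing x with
  | _ n ih =>
    obtain ⟨y, hadj, hy⟩ := exists_adj_dist_eq_succ hπ.connected hx
    obtain rfl | rfl := (hπ.adj_iff.1 hadj).2
    · omega
    · have hyp : y ≠ p := fun h => hx (h ▸ hπ.map_root)
      have := ih (H.dist p y) (by omega) hyp rfl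
      omega

theorem dist_map_le (hπ : IsParentMap H p π) (x : V) : H.dist p (π x) ≤ H.dist p x := by
  by_cases hx : x = p
  · rw [hx, hπ.map_root]
  · rw [hπ.dist_eq_dist_map_add_one hx]
    exact Nat.le_succ _

theorem map_eq_of_adj (hπ : IsParentMap H p π) (hxy : H.Adj x y)
    (hdist : H.dist p y = H.dist p x + 1) : π y = x := by
  refine (hπ.adj_iff.1 hxy).2.resolve_left ?_
  rintro rfl
  have := hπ.dist_map_le x
  omega

end IsParentMap

end RootedTree

section SchreierTree

open Matrix

variable {G X : Type*} [Group G] [MulAction G X] {S : Set G} {p x y : X} {π : X → X} {g s : G}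
  {n : ℕ}

namespace IsParentMap

section

open scoped Pointwise

theorem mem_coneLevel_one (hπ : IsParentMap (schreierGraph S X) p π) (hs : s ∈ S ∪ S⁻¹)
    (hne : s • x ≠ x) (hsx : π (s • x) = x) : s ∈ coneLevel S p x 1 := by
  refine (mem_coneLevel_one_iff hπ.connected).2 ⟨hs, ?_⟩
  rw [hπ.dist_eq_dist_map_add_one, hsx]
  intro hp
  rw [hp, hπ.map_root] at hsx
  exact hne (hp.trans hsx)

end

theorem notMem_coneLevel_one (hπ : IsParentMap (schreierGraph S X) p π)
    (hsx : s • x = x ∨ s • x = π x) : s ∉ coneLevel S p x 1 := by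
  intro hs
  have hdist := ((mem_coneLevel_one_iff hπ.connected).1 hs).2
  have hle : (schreierGraph S X).dist p (s • x) ≤ (schreierGraph S X).dist p x := by
    rcases hsx with hsx | hsx
    · rw [hsx]
    · exact hsx ▸ hπ.dist_map_le x
  omega

theorem iterate_smul (hπ : IsParentMap (schreierGraph S X) p π) (hg : g ∈ coneLevel S p x n) :
    π^[n] (g • x) = x := by
  induction n generalizing x g with
  | zero =>
    rw [coneLevel_zero hπ.connected] at hg
    rw [Set.mem_singleton_iff.1 hg, one_smul, Function.iterate_zero_apply]
  | succ n ih =>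
    rw [coneLevel_succ hπ.connected] at hg
    simp only [Set.mem_iUnion, Set.mem_image, exists_prop] at hg
    obtain ⟨s, hs, h, hh, rfl⟩ := hg
    obtain ⟨hsS, hdist⟩ := (mem_coneLevel_one_iff hπ.connected).1 hs
    have hne : x ≠ s • x := fun he => by rw [← he] at hdist; omega
    rw [mul_smul, Function.iterate_succ_apply', ih hh]
    exact hπ.map_eq_of_adj (schreierGraph_adj.2 ⟨hne, s, hsS, rfl⟩) hdist

theorem disjoint_coneEndpoints (hπ : IsParentMap (schreierGraph S X) p π) (hxy : x ≠ y) (n : ℕ) :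
    Disjoint (coneEndpoints S p x n) (coneEndpoints S p y n) := by
  rw [Set.disjoint_left]
  rintro _ ⟨g, hg, rfl⟩ ⟨h, hh, hgh⟩
  exact hxy ((hπ.iterate_smul hg).symm.trans ((congrArg π^[n] hgh.symm).trans (hπ.iterate_smul hh)))

variable {ι : Type*} [Fintype ι] {τ : X → ι} {E : ι → ι → Finset G}

theorem coneOrbitCount_eq_pow_mulVec [DecidableEq ι] (hπ : IsParentMap (schreierGraph S X) p π)
    (hE : IsConeAutomaton S p τ E) (hS : S.Finite) {B : Matrix ι ι ℕ}
    (hB : ∀ x j, ((· • x) '' (E (τ x) j : Set G)).ncard = B (τ x) j) (x : X) (n : ℕ) :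
    coneOrbitCount S p x n = (B ^ n *ᵥ 1) (τ x) := by
  induction n generalizing x with
  | zero => simp [coneOrbitCount_zero hπ.connected]
  | succ n ih =>
    have hfin (j : ι) : ((· • x) '' (E (τ x) j : Set G)).Finite :=
      (E (τ x) j).finite_toSet.image _
    have hdisj : Pairwise fun j k =>
        Disjoint ((· • x) '' (E (τ x) j : Set G)) ((· • x) '' (E (τ x) k : Set G)) :=
      fun j k hjk => Set.disjoint_left.2 fun y hj hk =>
        hjk ((hE.state_eq_of_mem_image hj).symm.trans (hE.state_eq_of_mem_image hk))
    have hcount (j : ι) (y : X) (hy : y ∈ (· • x) '' (E (τ x) j : Set G)) :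
        (coneEndpoints S p y n).ncard = 1 * (B ^ n *ᵥ 1) j := by
      rw [one_mul, ← coneOrbitCount_eq_ncard_coneEndpoints, ih, hE.state_eq_of_mem_image hy]
    rw [coneOrbitCount_eq_ncard_coneEndpoints, coneEndpoints_succ hπ.connected,
      Set.Finite.ncard_biUnion (finite_coneEndpoints hπ.connected hS)
        (fun y _ => finite_coneEndpoints hπ.connected hS)
        (fun y _ z _ hyz => hπ.disjoint_coneEndpoints hyz n),
      hE.coneEndpoints_one, finsum_mem_iUnion hdisj hfin, finsum_eq_sum_of_fintype, pow_succ',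
      ← Matrix.mulVec_mulVec]
    refine Finset.sum_congr rfl fun j _ => ?_
    rw [finsum_mem_congr rfl (hcount j), ← finsum_mem_mul' _ _ (hfin j), finsum_one, hB x]

theorem coneOrbitCount_succ (hπ : IsParentMap (schreierGraph S X) p π)
    (hE : IsConeAutomaton S p τ E) (hS : S.Finite) {B : Matrix ι ι ℕ}
    (hB : ∀ x j, ((· • x) '' (E (τ x) j : Set G)).ncard = B (τ x) j) {v : ι → X}
    (hv : ∀ j, τ (v j) = j) :
    coneOrbitCount S p x (n + 1) = ∑ j, B (τ x) j * coneOrbitCount S p (v j) n := by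
  classical
  simp only [hπ.coneOrbitCount_eq_pow_mulVec hE hS hB, hv, pow_succ', ← Matrix.mulVec_mulVec]
  rfl

end IsParentMap

end SchreierTree

section GrowthSeries

open PowerSeries Matrix

section Ring

variable {R ι : Type*} [Ring R] [Fintype ι] [DecidableEq ι]

/-- The geometric series `∑ Mᵏ zᵏ` of a matrix `M`, as a matrix of power series. -/
def geomSeriesMatrix (M : Matrix ι ι R) : Matrix ι ι (PowerSeries R) :=
  Matrix.of fun i j => PowerSeries.mk fun k => (M ^ k) i j

theorem X_smul_map_C_mul_geomSeriesMatrix (M : Matrix ι ι R) :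
    ((X : PowerSeries R) • M.map C) * geomSeriesMatrix M = geomSeriesMatrix M - 1 := by
  ext i j k
  rw [Matrix.smul_mul, Matrix.smul_apply, smul_eq_mul, Matrix.sub_apply, Matrix.mul_apply, map_sub]
  cases k with
  | zero => by_cases hij : i = j <;> simp [geomSeriesMatrix, Matrix.one_apply, hij]
  | succ k =>
    simp only [coeff_succ_X_mul, map_sum, geomSeriesMatrix, Matrix.map_apply, coeff_C_mul,
      Matrix.of_apply, coeff_mk, pow_succ', Matrix.mul_apply]
    by_cases hij : i = j <;> simp [Matrix.one_apply, hij, coeff_one]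

theorem geomSeriesMatrix_mul_X_smul_map_C (M : Matrix ι ι R) :
    geomSeriesMatrix M * ((X : PowerSeries R) • M.map C) = geomSeriesMatrix M - 1 := by
  ext i j k
  rw [Matrix.sub_apply, Matrix.mul_apply, map_sub, map_sum]
  simp only [Matrix.smul_apply, smul_eq_mul, Matrix.map_apply]
  cases k with
  | zero => by_cases hij : i = j <;> simp [geomSeriesMatrix, Matrix.one_apply, hij]
  | succ k =>
    simp only [geomSeriesMatrix, X_mul, ← mul_assoc, coeff_succ_mul_X, coeff_mul_C,
      Matrix.of_apply, coeff_mk, pow_succ, Matrix.mul_apply]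
    by_cases hij : i = j <;> simp [Matrix.one_apply, hij, coeff_one]

theorem isUnit_one_sub_X_smul_map_C (M : Matrix ι ι R) :
    IsUnit (1 - (X : PowerSeries R) • M.map C) := by
  refine ⟨⟨1 - (X : PowerSeries R) • M.map C, geomSeriesMatrix M, ?_, ?_⟩, rfl⟩
  · rw [sub_mul, one_mul, X_smul_map_C_mul_geomSeriesMatrix, sub_sub_cancel]
  · rw [mul_sub, mul_one, geomSeriesMatrix_mul_X_smul_map_C, sub_sub_cancel]

theorem mk_vecMul_one_sub_X_smul_map_C {M : Matrix ι ι R} {v : ι → ℕ → R}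
    (hv : ∀ i n, v i (n + 1) = ∑ j, v j n * M j i) :
    (fun i => PowerSeries.mk (v i)) ᵥ* (1 - (X : PowerSeries R) • M.map C) =
      fun i => C (v i 0) := by
  rw [Matrix.vecMul_sub, Matrix.vecMul_one]
  ext i k
  rw [Pi.sub_apply, map_sub, Matrix.vecMul, dotProduct, map_sum]
  simp only [Matrix.smul_apply, smul_eq_mul, Matrix.map_apply, coeff_mk]
  cases k with
  | zero => simp
  | succ k =>
    simp only [X_mul, ← mul_assoc, coeff_succ_mul_X, coeff_mul_C, coeff_mk, hv, sub_self]
    simp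

end Ring

theorem mk_eq_inv_one_sub_X_smul_map_C_mulVec {R ι : Type*} [CommRing R] [Fintype ι]
    [DecidableEq ι] {M : Matrix ι ι R} {v : ι → ℕ → R}
    (hv : ∀ i n, v i (n + 1) = ∑ j, M i j * v j n) :
    (fun i => PowerSeries.mk (v i)) =
      (1 - (X : PowerSeries R) • M.map C)⁻¹ *ᵥ fun i => C (v i 0) := by
  have hv' (i : ι) (n : ℕ) : v i (n + 1) = ∑ j, v j n * Mᵀ j i :=
    (hv i n).trans (Finset.sum_congr rfl fun j _ => mul_comm _ _)
  have := (isUnit_one_sub_X_smul_map_C M).invertible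
  refine (Matrix.inv_mulVec_eq_vec ?_).symm
  rw [← mk_vecMul_one_sub_X_smul_map_C hv', ← Matrix.vecMul_transpose, Matrix.transpose_sub,
    Matrix.transpose_one, Matrix.transpose_smul, Matrix.transpose_map]

theorem inv_one_sub_C_mul_X {k : Type*} [Field k] (r : k) :
    (1 - C r * X : PowerSeries k)⁻¹ = PowerSeries.mk fun n => r ^ n := by
  rw [eq_comm, PowerSeries.eq_inv_iff_mul_eq_one (by simp)]
  ext n
  rw [mul_sub, mul_one, map_sub, ← mul_assoc]
  cases n with
  | zero => simp
  | succ n => simp [coeff_succ_mul_X, coeff_mul_C, coeff_one, pow_succ]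

end GrowthSeries

section GoldenRatio

open PowerSeries Real
open scoped goldenRatio

theorem one_add_X_mul_inv_one_sub_X_sub_X_sq :
    (1 + X) * (1 - X - X ^ 2 : PowerSeries ℝ)⁻¹ =
      C (φ ^ 2 / √5) * (1 - C φ * X)⁻¹ - C (ψ ^ 2 / √5) * (1 - C ψ * X)⁻¹ := by
  have hsum : C φ + C ψ = (1 : PowerSeries ℝ) := by
    rw [← map_add, goldenRatio_add_goldenConj, map_one]
  have hmul : C φ * C ψ = (-1 : PowerSeries ℝ) := by
    rw [← map_mul, goldenRatio_mul_goldenConj, map_neg, map_one]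
  have hdiff : (C φ - C ψ) * C (√5)⁻¹ = (1 : PowerSeries ℝ) := by
    rw [← map_sub, ← map_mul, goldenRatio_sub_goldenConj, mul_inv_cancel₀ (by positivity), map_one]
  have hfactor : (1 - X - X ^ 2 : PowerSeries ℝ) = (1 - C φ * X) * (1 - C ψ * X) := by
    linear_combination X * hsum - X ^ 2 * hmul
  have hnum : (1 + X : PowerSeries ℝ) =
      C (φ ^ 2 / √5) * (1 - C ψ * X) - C (ψ ^ 2 / √5) * (1 - C φ * X) := by
    rw [div_eq_mul_inv, div_eq_mul_inv, map_mul, map_mul, map_pow, map_pow]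
    linear_combination (-1 - X) * hdiff + (C ψ - C φ) * C (√5)⁻¹ * hsum +
      (C φ - C ψ) * C (√5)⁻¹ * X * hmul
  have hφ : (1 - C φ * X : PowerSeries ℝ) * (1 - C φ * X)⁻¹ = 1 :=
    PowerSeries.mul_inv_cancel _ (by simp)
  have hψ : (1 - C ψ * X : PowerSeries ℝ) * (1 - C ψ * X)⁻¹ = 1 :=
    PowerSeries.mul_inv_cancel _ (by simp)
  rw [hfactor, PowerSeries.mul_inv_rev, hnum]
  linear_combination C (φ ^ 2 / √5) * (1 - C φ * X)⁻¹ * hψ - C (ψ ^ 2 / √5) * (1 - C ψ * X)⁻¹ * hφ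

theorem coeff_one_add_X_mul_inv_one_sub_X_sub_X_sq (n : ℕ) :
    coeff n ((1 + X) * (1 - X - X ^ 2 : PowerSeries ℝ)⁻¹) = (φ ^ (n + 2) - ψ ^ (n + 2)) / √5 := by
  rw [one_add_X_mul_inv_one_sub_X_sub_X_sq, inv_one_sub_C_mul_X, inv_one_sub_C_mul_X, map_sub,
    coeff_C_mul, coeff_C_mul, coeff_mk, coeff_mk]
  ring

theorem sum_range_succ_pow_add_two {k : Type*} [Field k] {r : k} (hr : r ≠ 1) (n : ℕ) :
    ∑ m ∈ Finset.range (n + 1), r ^ (m + 2) = (r ^ (n + 3) - r ^ 2) / (r - 1) := by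
  rw [Finset.sum_congr rfl fun m _ => pow_add r m 2]
  rw [← Finset.sum_mul, geom_sum_eq hr, div_mul_eq_mul_div]
  ring

theorem sum_range_succ_goldenRatio_pow_sub_goldenConj_pow (n : ℕ) :
    ∑ m ∈ Finset.range (n + 1), (φ ^ (m + 2) - ψ ^ (m + 2)) / √5 =
      (φ ^ (n + 3) - φ ^ 2) / (√5 * (φ - 1)) - (ψ ^ (n + 3) - ψ ^ 2) / (√5 * (ψ - 1)) := by
  have hψ : ψ ≠ 1 := (goldenConj_neg.trans one_pos).ne
  rw [← Finset.sum_div, Finset.sum_sub_distrib, sum_range_succ_pow_add_two one_lt_goldenRatio.ne',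
    sum_range_succ_pow_add_two hψ, sub_div, div_div, div_div, mul_comm, mul_comm (ψ - 1)]

end GoldenRatio

namespace Thompson

open PowerSeries Real unitInterval
open scoped Pointwise

section ParentMap

/-- The letter leading from a dyadic number in `(0, 1)` one step towards `1/2` in `𝓗`; it is `1`
at `1/2` itself. -/
noncomputable def parentElt (t : Dyadics) : F :=
  if (t.1 : ℝ) < 1 / 2 then a⁻¹ else if (t.1 : ℝ) ≤ 1 / 2 then 1 else
    if (t.1 : ℝ) < 3 / 4 then b⁻¹ else a

theorem coe_parentElt_smul (t : Dyadics) : ((parentElt t • t).1 : ℝ) =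
    if (t.1 : ℝ) ≤ 1 / 4 then 2 * (t.1 : ℝ) else if (t.1 : ℝ) < 1 / 2 then (t.1 : ℝ) + 1 / 4 else
      if (t.1 : ℝ) ≤ 1 / 2 then (t.1 : ℝ) else if (t.1 : ℝ) ≤ 5 / 8 then 2 * (t.1 : ℝ) - 1 / 2 else
        if (t.1 : ℝ) < 3 / 4 then (t.1 : ℝ) + 1 / 8 else 2 * (t.1 : ℝ) - 1 := by
  have ha : ((a • t).1 : ℝ) = if (t.1 : ℝ) ≤ 1 / 2 then (t.1 : ℝ) / 2 else
      if (t.1 : ℝ) ≤ 3 / 4 then (t.1 : ℝ) - 1 / 4 else 2 * (t.1 : ℝ) - 1 := rfl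
  have ha' : ((a⁻¹ • t).1 : ℝ) = if (t.1 : ℝ) ≤ 1 / 4 then 2 * (t.1 : ℝ) else
      if (t.1 : ℝ) ≤ 1 / 2 then (t.1 : ℝ) + 1 / 4 else ((t.1 : ℝ) + 1) / 2 := rfl
  have hb' : ((b⁻¹ • t).1 : ℝ) = if (t.1 : ℝ) ≤ 1 / 2 then (t.1 : ℝ) else
      if (t.1 : ℝ) ≤ 5 / 8 then 2 * (t.1 : ℝ) - 1 / 2 else
        if (t.1 : ℝ) ≤ 3 / 4 then (t.1 : ℝ) + 1 / 8 else ((t.1 : ℝ) + 1) / 2 := rfl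
  rw [parentElt]
  split_ifs <;> grind [one_smul]

/-- The multiples of `2⁻ⁿ`. -/
noncomputable def dyadicGrid (n : ℕ) : AddSubgroup ℝ := AddSubgroup.zmultiples ((1 / 2) ^ n)

theorem isDyadic_iff_exists_mem_dyadicGrid {t : ℝ} : IsDyadic t ↔ ∃ n, t ∈ dyadicGrid n := by
  simp only [IsDyadic, dyadicGrid, AddSubgroup.mem_zmultiples_iff]
  rw [exists_comm]
  exact exists₂_congr fun n m => by simp [div_eq_mul_inv, eq_comm]

theorem one_half_pow_mem_dyadicGrid {m n : ℕ} (hmn : m ≤ n) :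
    (1 / 2 : ℝ) ^ m ∈ dyadicGrid n := by
  obtain ⟨k, rfl⟩ := Nat.exists_eq_add_of_le hmn
  refine AddSubgroup.mem_zmultiples_iff.2 ⟨2 ^ k, ?_⟩
  rw [zsmul_eq_mul, pow_add]
  push_cast
  rw [mul_left_comm, ← mul_pow]
  norm_num

theorem dyadicGrid_mono : Monotone dyadicGrid := fun _ _ hmn =>
  AddSubgroup.zmultiples_le_of_mem (one_half_pow_mem_dyadicGrid hmn)

theorem two_mul_mem_dyadicGrid {n : ℕ} {t : ℝ} (ht : t ∈ dyadicGrid (n + 1)) :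
    2 * t ∈ dyadicGrid n := by
  obtain ⟨m, rfl⟩ := AddSubgroup.mem_zmultiples_iff.1 ht
  refine AddSubgroup.mem_zmultiples_iff.2 ⟨m, ?_⟩
  simp only [zsmul_eq_mul, pow_succ]
  ring

theorem three_le_of_mem_dyadicGrid {n : ℕ} {t : ℝ} {k : ℤ} (ht : t ∈ dyadicGrid n)
    (hk : k < 4 * t) (hk' : 4 * t < k + 1) : 3 ≤ n := by
  by_contra hn
  obtain ⟨m, hm⟩ := AddSubgroup.mem_zmultiples_iff.1 (dyadicGrid_mono (by omega : n ≤ 2) ht)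
  have hm : 4 * t = m := by
    rw [← hm, zsmul_eq_mul]
    ring
  rw [hm] at hk hk'
  norm_cast at hk hk'
  omega

/-- The map moving every dyadic number in `(0, 1)` one step towards `1/2` in `𝓗`. -/
noncomputable def towardHalf (t : Dyadics) : Dyadics := parentElt t • t

/-- The dyadic numbers in `(0, 1)` whose denominator divides `2ⁿ`. -/
def gridPoints (n : ℕ) : Set Dyadics :=
  {t | (0 < (t.1 : ℝ) ∧ (t.1 : ℝ) < 1) ∧ (t.1 : ℝ) ∈ dyadicGrid n}

variable {t : Dyadics} {n : ℕ}

theorem gridPoints_zero : gridPoints 0 = ∅ := by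
  refine Set.eq_empty_of_forall_notMem fun t ⟨⟨h0, h1⟩, ht⟩ => ?_
  obtain ⟨m, hm⟩ := AddSubgroup.mem_zmultiples_iff.1 ht
  rw [zsmul_eq_mul, pow_zero, mul_one] at hm
  rw [← hm] at h0 h1
  norm_cast at h0 h1
  omega

theorem towardHalf_mem_gridPoints_of_double (ht : t ∈ gridPoints (n + 1))
    (h : (t.1 : ℝ) ≤ 1 / 4 ∨ 1 / 2 < (t.1 : ℝ) ∧ (t.1 : ℝ) ≤ 5 / 8 ∨ 3 / 4 ≤ (t.1 : ℝ)) :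
    towardHalf t ∈ gridPoints n := by
  obtain ⟨⟨h0, h1⟩, ht⟩ := ht
  have hval := coe_parentElt_smul t
  refine ⟨by grind [towardHalf], ?_⟩
  rcases h with h | h | h
  · have hval : ((towardHalf t).1 : ℝ) = 2 * t.1 := by grind [towardHalf]
    exact hval ▸ two_mul_mem_dyadicGrid ht
  · have hn := three_le_of_mem_dyadicGrid (k := 2) ht (by norm_num; linarith)
      (by norm_num; linarith)
    have hval : ((towardHalf t).1 : ℝ) = 2 * t.1 - (1 / 2) ^ 1 := by grind [towardHalf]
    exact hval ▸ sub_mem (two_mul_mem_dyadicGrid ht) (one_half_pow_mem_dyadicGrid (by omega))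
  · have hval : ((towardHalf t).1 : ℝ) = 2 * t.1 - (1 / 2) ^ 0 := by grind [towardHalf]
    exact hval ▸ sub_mem (two_mul_mem_dyadicGrid ht) (one_half_pow_mem_dyadicGrid n.zero_le)

theorem towardHalf_mem_gridPoints_of_translate (ht : t ∈ gridPoints n)
    (h : 1 / 4 < (t.1 : ℝ) ∧ (t.1 : ℝ) < 1 / 2 ∨ 5 / 8 < (t.1 : ℝ) ∧ (t.1 : ℝ) < 3 / 4) :
    towardHalf t ∈ gridPoints n := by
  obtain ⟨⟨h0, h1⟩, ht⟩ := ht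
  have hval := coe_parentElt_smul t
  refine ⟨by grind [towardHalf], ?_⟩
  rcases h with h | h
  · have hn := three_le_of_mem_dyadicGrid (k := 1) ht (by norm_num; linarith)
      (by norm_num; linarith)
    have hval : ((towardHalf t).1 : ℝ) = t.1 + (1 / 2) ^ 2 := by grind [towardHalf]
    exact hval ▸ add_mem ht (one_half_pow_mem_dyadicGrid (by omega))
  · have hn := three_le_of_mem_dyadicGrid (k := 2) ht (by norm_num; linarith)
      (by norm_num; linarith)
    have hval : ((towardHalf t).1 : ℝ) = t.1 + (1 / 2) ^ 3 := by grind [towardHalf]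
    exact hval ▸ add_mem ht (one_half_pow_mem_dyadicGrid hn)

theorem exists_iterate_towardHalf_mem_gridPoints (ht : t ∈ gridPoints (n + 1))
    (hne : t ≠ half) : ∃ k, towardHalf^[k] t ∈ gridPoints n := by
  have hhalf : (t.1 : ℝ) ≠ 1 / 2 := fun h => hne (Subtype.ext (Subtype.ext h))
  have hright (u : Dyadics) (hu : u ∈ gridPoints (n + 1)) (hu' : 1 / 2 < (u.1 : ℝ)) :
      ∃ k, towardHalf^[k] u ∈ gridPoints n := by
    by_cases h : 5 / 8 < (u.1 : ℝ) ∧ (u.1 : ℝ) < 3 / 4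
    · have hval : ((towardHalf u).1 : ℝ) = u.1 + 1 / 8 := by
        grind [towardHalf, coe_parentElt_smul]
      exact ⟨2, towardHalf_mem_gridPoints_of_double
        (towardHalf_mem_gridPoints_of_translate hu (Or.inr h)) (by grind)⟩
    · exact ⟨1, towardHalf_mem_gridPoints_of_double hu (by grind)⟩
  by_cases h : 1 / 4 < (t.1 : ℝ) ∧ (t.1 : ℝ) < 1 / 2
  · have hval : ((towardHalf t).1 : ℝ) = t.1 + 1 / 4 := by
      grind [towardHalf, coe_parentElt_smul]
    obtain ⟨k, hk⟩ := hright _ (towardHalf_mem_gridPoints_of_translate ht (Or.inl h)) (by grind)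
    exact ⟨k + 1, hk⟩
  · rcases lt_or_ge (t.1 : ℝ) (1 / 2) with hlt | hge
    · exact ⟨1, towardHalf_mem_gridPoints_of_double ht (by grind)⟩
    · exact hright t ht (hge.lt_of_ne' hhalf)

theorem exists_iterate_towardHalf_eq_half (h0 : 0 < (t.1 : ℝ)) (h1 : (t.1 : ℝ) < 1) :
    ∃ k, towardHalf^[k] t = half := by
  obtain ⟨n, hn⟩ := isDyadic_iff_exists_mem_dyadicGrid.1 t.2
  have ht : t ∈ gridPoints n := ⟨⟨h0, h1⟩, hn⟩
  clear hn h0 h1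
  induction n generalizing t with
  | zero => exact absurd ht (gridPoints_zero ▸ Set.notMem_empty t)
  | succ n ih =>
    by_cases hne : t = half
    · exact ⟨0, hne⟩
    obtain ⟨k, hk⟩ := exists_iterate_towardHalf_mem_gridPoints ht hne
    obtain ⟨l, hl⟩ := ih hk
    exact ⟨l + k, by rw [Function.iterate_add_apply, hl]⟩

theorem pos_and_lt_one_of_mem_orbit (ht : t ∈ MulAction.orbit F half) :
    0 < (t.1 : ℝ) ∧ (t.1 : ℝ) < 1 := by
  obtain ⟨f, rfl⟩ := ht
  have hf : StrictMono (f : I ≃ₜ I) := IsThompson.strictMono f.2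
  have h0 : (0 : I) < half.1 := Subtype.coe_lt_coe.1 (by norm_num [half])
  have h1 : half.1 < (1 : I) := Subtype.coe_lt_coe.1 (by norm_num [half])
  exact ⟨lt_of_le_of_lt nonneg' (hf h0), lt_of_lt_of_le (hf h1) le_one'⟩

theorem iterate_towardHalf_mem_orbit (t : Dyadics) (k : ℕ) :
    towardHalf^[k] t ∈ MulAction.orbit F t := by
  induction k with
  | zero => exact MulAction.mem_orbit_self t
  | succ k ih =>
    rw [Function.iterate_succ_apply']
    exact MulAction.mem_orbit_of_mem_orbit _ ih

theorem mem_orbit_half_iff : t ∈ MulAction.orbit F half ↔ 0 < (t.1 : ℝ) ∧ (t.1 : ℝ) < 1 := by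
  refine ⟨pos_and_lt_one_of_mem_orbit, fun ⟨h0, h1⟩ => MulAction.mem_orbit_symm.1 ?_⟩
  obtain ⟨k, hk⟩ := exists_iterate_towardHalf_eq_half h0 h1
  exact hk ▸ iterate_towardHalf_mem_orbit t k

end ParentMap

section SchreierGraph

variable {x y : Vertex} {s : F}

theorem Vertex.ext_val (h : x.val = y.val) : x = y := Subtype.ext (Subtype.ext (Subtype.ext h))

theorem Vertex.val_pos (x : Vertex) : 0 < x.val := (pos_and_lt_one_of_mem_orbit x.2).1

theorem Vertex.val_lt_one (x : Vertex) : x.val < 1 := (pos_and_lt_one_of_mem_orbit x.2).2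

theorem val_basePt : basePt.val = 1 / 2 := rfl

theorem eq_basePt_iff : x = basePt ↔ x.val = 1 / 2 :=
  ⟨fun h => h ▸ val_basePt, fun h => Vertex.ext_val (h.trans val_basePt.symm)⟩

theorem val_a_smul (x : Vertex) : (a • x).val = if x.val ≤ 1 / 2 then x.val / 2 else
    if x.val ≤ 3 / 4 then x.val - 1 / 4 else 2 * x.val - 1 := rfl

theorem val_a_inv_smul (x : Vertex) : (a⁻¹ • x).val = if x.val ≤ 1 / 4 then 2 * x.val else
    if x.val ≤ 1 / 2 then x.val + 1 / 4 else (x.val + 1) / 2 := rfl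

theorem val_b_smul (x : Vertex) : (b • x).val = if x.val ≤ 1 / 2 then x.val else
    if x.val ≤ 3 / 4 then x.val / 2 + 1 / 4 else
      if x.val ≤ 7 / 8 then x.val - 1 / 8 else 2 * x.val - 1 := rfl

theorem val_b_inv_smul (x : Vertex) : (b⁻¹ • x).val = if x.val ≤ 1 / 2 then x.val else
    if x.val ≤ 5 / 8 then 2 * x.val - 1 / 2 else
      if x.val ≤ 3 / 4 then x.val + 1 / 8 else (x.val + 1) / 2 := rfl

theorem b_inv_smul_eq_a_inv_smul (hx : 3 / 4 ≤ x.val) : b⁻¹ • x = a⁻¹ • x :=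
  Vertex.ext_val (by grind [val_a_inv_smul, val_b_inv_smul])

/-- The neighbour of a vertex of `𝓗` on the way to `1/2`. -/
noncomputable def parent (x : Vertex) : Vertex := parentElt x.1 • x

theorem val_parent (x : Vertex) : (parent x).val =
    if x.val ≤ 1 / 4 then 2 * x.val else if x.val < 1 / 2 then x.val + 1 / 4 else
      if x.val ≤ 1 / 2 then x.val else if x.val ≤ 5 / 8 then 2 * x.val - 1 / 2 else
        if x.val < 3 / 4 then x.val + 1 / 8 else 2 * x.val - 1 :=
  coe_parentElt_smul x.1

theorem parent_a_smul (hx : x.val < 3 / 4) : parent (a • x) = x :=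
  Vertex.ext_val (by grind [val_parent, val_a_smul, x.val_pos])

theorem a_smul_eq_parent (hx : 3 / 4 ≤ x.val) : a • x = parent x :=
  Vertex.ext_val (by grind [val_parent, val_a_smul])

theorem b_smul_eq_self (hx : x.val ≤ 1 / 2) : b • x = x :=
  Vertex.ext_val (by grind [val_b_smul])

theorem parent_b_smul (hx : 1 / 2 < x.val) (hx' : x.val < 7 / 8) : parent (b • x) = x :=
  Vertex.ext_val (by grind [val_parent, val_b_smul])

theorem b_smul_eq_parent (hx : 7 / 8 ≤ x.val) : b • x = parent x :=
  Vertex.ext_val (by grind [val_parent, val_b_smul])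

theorem smul_eq_self_or_eq_parent_or_parent_smul (hs : s ∈ gens) (x : Vertex) :
    s • x = x ∨ s • x = parent x ∨ parent (s • x) = x := by
  obtain rfl | rfl : s = a ∨ s = b := hs
  · rcases lt_or_ge x.val (3 / 4) with hx | hx
    · exact Or.inr (Or.inr (parent_a_smul hx))
    · exact Or.inr (Or.inl (a_smul_eq_parent hx))
  · rcases le_or_gt x.val (1 / 2) with hx | hx
    · exact Or.inl (b_smul_eq_self hx)
    rcases lt_or_ge x.val (7 / 8) with hx' | hx'
    · exact Or.inr (Or.inr (parent_b_smul hx hx'))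
    · exact Or.inr (Or.inl (b_smul_eq_parent hx'))

theorem adj_parent (hx : parent x ≠ x) : (schreierGraph gens Vertex).Adj x (parent x) := by
  refine schreierGraph_adj.2 ⟨hx.symm, parentElt x.1, ?_, rfl⟩
  rw [parent] at hx
  revert hx
  rw [parentElt]
  split_ifs <;> simp [gens]

theorem isParentMap_parent : IsParentMap (schreierGraph gens Vertex) basePt parent where
  map_root := Vertex.ext_val (by rw [val_parent, val_basePt]; norm_num)
  exists_iterate_eq_root x := by
    obtain ⟨k, hk⟩ := exists_iterate_towardHalf_eq_half x.val_pos x.val_lt_one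
    have hsemi : Function.Semiconj Subtype.val parent towardHalf := fun _ => rfl
    exact ⟨k, Subtype.ext ((hsemi.iterate_right k x).trans hk)⟩
  adj_iff {x y} := by
    refine ⟨fun hxy => ⟨hxy.ne, ?_⟩, ?_⟩
    · obtain ⟨hne, s, hs | hs, rfl⟩ := schreierGraph_adj.1 hxy
      · exact ((smul_eq_self_or_eq_parent_or_parent_smul hs x).resolve_left hne.symm).imp_left
          Eq.symm
      · have hpar := smul_eq_self_or_eq_parent_or_parent_smul hs (s • x)
        rw [inv_smul_smul] at hpar
        exact (hpar.resolve_left hne).symm.imp_right Eq.symm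
    · rintro ⟨hne, rfl | rfl⟩
      · exact adj_parent hne.symm
      · exact (adj_parent hne).symm

theorem schreierGraph_gens_connected : (schreierGraph gens Vertex).Connected :=
  isParentMap_parent.connected

theorem finite_gens : gens.Finite := Set.toFinite {a, b}

theorem a_mem_coneLevel_one_iff : a ∈ coneLevel gens basePt x 1 ↔ x.val < 3 / 4 := by
  refine ⟨fun ha => ?_, fun hx => ?_⟩
  · by_contra! hx
    exact isParentMap_parent.notMem_coneLevel_one (Or.inr (a_smul_eq_parent hx)) ha
  · refine isParentMap_parent.mem_coneLevel_one (by simp [gens]) (fun h => ?_) (parent_a_smul hx)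
    grind [val_a_smul, x.val_pos]

theorem a_inv_mem_coneLevel_one_iff : a⁻¹ ∈ coneLevel gens basePt x 1 ↔ 1 / 2 ≤ x.val := by
  refine ⟨fun ha => ?_, fun hx => ?_⟩
  · by_contra! hx
    refine isParentMap_parent.notMem_coneLevel_one (Or.inr (Vertex.ext_val ?_)) ha
    grind [val_parent, val_a_inv_smul]
  · refine isParentMap_parent.mem_coneLevel_one (by simp [gens]) (fun h => ?_) (Vertex.ext_val ?_)
    · grind [val_a_inv_smul, x.val_lt_one]
    · grind [val_parent, val_a_inv_smul]

theorem b_mem_coneLevel_one_iff :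
    b ∈ coneLevel gens basePt x 1 ↔ 1 / 2 < x.val ∧ x.val < 7 / 8 := by
  refine ⟨fun hb => ⟨?_, ?_⟩, fun ⟨hx, hx'⟩ => ?_⟩
  · by_contra! hx
    exact isParentMap_parent.notMem_coneLevel_one (Or.inl (b_smul_eq_self hx)) hb
  · by_contra! hx
    exact isParentMap_parent.notMem_coneLevel_one (Or.inr (b_smul_eq_parent hx)) hb
  · refine isParentMap_parent.mem_coneLevel_one (by simp [gens]) (fun h => ?_)
      (parent_b_smul hx hx')
    grind [val_b_smul]

theorem b_inv_mem_coneLevel_one_iff : b⁻¹ ∈ coneLevel gens basePt x 1 ↔ 3 / 4 ≤ x.val := by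
  refine ⟨fun hb => ?_, fun hx => ?_⟩
  · by_contra! hx
    have hval : (b⁻¹ • x).val = x.val ∨ (b⁻¹ • x).val = (parent x).val := by
      grind [val_parent, val_b_inv_smul]
    exact isParentMap_parent.notMem_coneLevel_one (hval.imp Vertex.ext_val Vertex.ext_val) hb
  · refine isParentMap_parent.mem_coneLevel_one (by simp [gens]) (fun h => ?_) (Vertex.ext_val ?_)
    · grind [val_b_inv_smul, x.val_lt_one]
    · grind [val_parent, val_b_inv_smul]

end SchreierGraph

section ConeTypes

variable {x y : Vertex} {i j : Fin 5} {s : F}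

/-- The type of a vertex, read off from its position in `(0, 1)`: the white vertices adjacent to a
grey vertex other than `1/2` are those in `[3/4, 7/8)`. -/
noncomputable def vertexType (x : Vertex) : Fin 5 :=
  if x.val < 1 / 2 then 1 else if x.val ≤ 1 / 2 then 0 else if x.val < 3 / 4 then 2 else
    if x.val < 7 / 8 then 3 else 4

theorem vertexType_eq_zero_iff : vertexType x = 0 ↔ x.val = 1 / 2 := by
  unfold vertexType; split_ifs <;> simp <;> grind

theorem vertexType_eq_one_iff : vertexType x = 1 ↔ x.val < 1 / 2 := by
  unfold vertexType; split_ifs <;> simp <;> grind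

theorem vertexType_eq_two_iff : vertexType x = 2 ↔ 1 / 2 < x.val ∧ x.val < 3 / 4 := by
  unfold vertexType; split_ifs <;> simp <;> grind

theorem vertexType_eq_three_iff : vertexType x = 3 ↔ 3 / 4 ≤ x.val ∧ x.val < 7 / 8 := by
  unfold vertexType; split_ifs <;> simp <;> grind

theorem vertexType_eq_four_iff : vertexType x = 4 ↔ 7 / 8 ≤ x.val := by
  unfold vertexType; split_ifs <;> simp <;> grind

theorem isWhite_and_onTree_iff : IsWhite x ∧ OnTree x ↔ 3 / 4 ≤ x.val ∧ x.val < 7 / 8 := by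
  refine and_congr_right fun (hx : 3 / 4 ≤ x.val) => ⟨fun hT => ?_, fun hx' => Or.inr ⟨hx, ?_⟩⟩
  · obtain ⟨⟨-, hx'⟩, -⟩ | ⟨-, y, ⟨hy, hy'⟩, hne, hadj⟩ := hT
    · exact absurd hx' hx.not_gt
    · rw [Ne, eq_basePt_iff] at hne
      have hpar := (isParentMap_parent.adj_iff.1 hadj).2
      have hval : (parent x).val = y.val ∨ (parent y).val = x.val :=
        hpar.imp (congrArg Vertex.val) (congrArg Vertex.val)
      grind [val_parent]
  · refine ⟨b • x, ?_, ?_, ?_⟩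
    · unfold IsGrey
      grind [val_b_smul]
    · rw [Ne, eq_basePt_iff, val_b_smul]
      split_ifs <;> linarith
    · refine schreierGraph_adj.2 ⟨fun h => ?_, b, Or.inl (Or.inr rfl), rfl⟩
      have hval := congrArg Vertex.val h
      grind [val_b_smul]

theorem hasType_iff : HasType x i ↔ vertexType x = i := by
  fin_cases i
  · exact eq_basePt_iff.trans vertexType_eq_zero_iff.symm
  · exact vertexType_eq_one_iff.symm
  · refine Iff.trans ?_ vertexType_eq_two_iff.symm
    change (1 / 2 ≤ x.val ∧ x.val < 3 / 4) ∧ x ≠ basePt ↔ _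
    grind [eq_basePt_iff]
  · exact isWhite_and_onTree_iff.trans vertexType_eq_three_iff.symm
  · refine Iff.trans ?_ vertexType_eq_four_iff.symm
    change IsWhite x ∧ ¬ OnTree x ↔ _
    have hx := isWhite_and_onTree_iff (x := x)
    unfold IsWhite at hx ⊢
    grind

theorem vertexType_surjective : Function.Surjective vertexType := by
  have h1 := val_basePt
  intro i
  fin_cases i
  · exact ⟨basePt, vertexType_eq_zero_iff.2 h1⟩
  · exact ⟨a • basePt, vertexType_eq_one_iff.2 (by norm_num [val_a_smul, h1])⟩
  · exact ⟨b • a⁻¹ • basePt, vertexType_eq_two_iff.2 (by norm_num [val_a_inv_smul, val_b_smul, h1])⟩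
  · exact ⟨a⁻¹ • basePt, vertexType_eq_three_iff.2 (by norm_num [val_a_inv_smul, h1])⟩
  · exact ⟨a⁻¹ • a⁻¹ • basePt, vertexType_eq_four_iff.2 (by norm_num [val_a_inv_smul, h1])⟩

theorem existsUnique_hasType (x : Vertex) : ∃! i, HasType x i :=
  ⟨vertexType x, hasType_iff.2 rfl, fun _ hi => (hasType_iff.1 hi).symm⟩

theorem exists_hasType (i : Fin 5) : ∃ x, HasType x i :=
  (vertexType_surjective i).imp fun _ => hasType_iff.2

open Classical in
/-- The automaton of cone types: the letters leading from a vertex of type `i` away from `1/2` to a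
vertex of type `j`. -/
noncomputable def transition : Fin 5 → Fin 5 → Finset F :=
  ![![∅, {a}, ∅, {a⁻¹}, ∅],
    ![∅, {a}, ∅, ∅, ∅],
    ![∅, {a}, {b}, {a⁻¹}, ∅],
    ![∅, ∅, {b}, ∅, {a⁻¹, b⁻¹}],
    ![∅, ∅, ∅, ∅, {a⁻¹, b⁻¹}]]

theorem mem_coneLevel_one_iff_eq_letter : s ∈ coneLevel gens basePt x 1 ↔
    s = a ∧ x.val < 3 / 4 ∨ s = a⁻¹ ∧ 1 / 2 ≤ x.val ∨
      s = b ∧ (1 / 2 < x.val ∧ x.val < 7 / 8) ∨ s = b⁻¹ ∧ 3 / 4 ≤ x.val := by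
  rw [← a_mem_coneLevel_one_iff, ← a_inv_mem_coneLevel_one_iff, ← b_mem_coneLevel_one_iff,
    ← b_inv_mem_coneLevel_one_iff]
  refine ⟨fun hs => ?_, ?_⟩
  · obtain (rfl | rfl) | hs' := ((mem_coneLevel_one_iff schreierGraph_gens_connected).1 hs).1
    · exact Or.inl ⟨rfl, hs⟩
    · exact Or.inr (Or.inr (Or.inl ⟨rfl, hs⟩))
    · obtain h | h : s⁻¹ = a ∨ s⁻¹ = b := hs'
      · obtain rfl := inv_eq_iff_eq_inv.1 h
        exact Or.inr (Or.inl ⟨rfl, hs⟩)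
      · obtain rfl := inv_eq_iff_eq_inv.1 h
        exact Or.inr (Or.inr (Or.inr ⟨rfl, hs⟩))
  · rintro (⟨rfl, hs⟩ | ⟨rfl, hs⟩ | ⟨rfl, hs⟩ | ⟨rfl, hs⟩) <;> exact hs

theorem mem_transition_vertexType_iff : s ∈ transition (vertexType x) j ↔
    s = a ∧ x.val < 3 / 4 ∧ j = 1 ∨
      s = a⁻¹ ∧ 1 / 2 ≤ x.val ∧ (if x.val < 3 / 4 then j = 3 else j = 4) ∨
      s = b ∧ (1 / 2 < x.val ∧ x.val < 7 / 8) ∧ j = 2 ∨ s = b⁻¹ ∧ 3 / 4 ≤ x.val ∧ j = 4 := by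
  unfold vertexType
  split_ifs <;> fin_cases j <;> simp [transition] <;> grind

theorem vertexType_a_smul (hx : x.val < 3 / 4) : vertexType (a • x) = 1 :=
  vertexType_eq_one_iff.2 (by grind [val_a_smul])

theorem vertexType_a_inv_smul (hx : 1 / 2 ≤ x.val) :
    vertexType (a⁻¹ • x) = if x.val < 3 / 4 then 3 else 4 := by
  split_ifs
  · exact vertexType_eq_three_iff.2 (by grind [val_a_inv_smul])
  · exact vertexType_eq_four_iff.2 (by grind [val_a_inv_smul])

theorem vertexType_b_smul (hx : 1 / 2 < x.val) (hx' : x.val < 7 / 8) : vertexType (b • x) = 2 :=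
  vertexType_eq_two_iff.2 (by grind [val_b_smul])

theorem vertexType_b_inv_smul (hx : 3 / 4 ≤ x.val) : vertexType (b⁻¹ • x) = 4 :=
  vertexType_eq_four_iff.2 (by grind [val_b_inv_smul])

theorem isConeAutomaton_transition : IsConeAutomaton gens basePt vertexType transition := by
  intro x j s
  rw [mem_transition_vertexType_iff, mem_coneLevel_one_iff_eq_letter]
  grind [vertexType_a_smul, vertexType_a_inv_smul, vertexType_b_smul, vertexType_b_inv_smul]

theorem coneType_eq_iff_vertexType_eq :
    coneType gens basePt x = coneType gens basePt y ↔ vertexType x = vertexType y := by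
  refine ⟨fun h => ?_, fun h => ?_⟩
  · have hlevel : ∀ s, s ∈ coneLevel gens basePt x 1 ↔ s ∈ coneLevel gens basePt y 1 := fun s => by
      rw [coneLevel_congr h]
    have ha := hlevel a
    have ha' := hlevel a⁻¹
    have hb := hlevel b
    have hb' := hlevel b⁻¹
    rw [a_mem_coneLevel_one_iff, a_mem_coneLevel_one_iff] at ha
    rw [a_inv_mem_coneLevel_one_iff, a_inv_mem_coneLevel_one_iff] at ha'
    rw [b_mem_coneLevel_one_iff, b_mem_coneLevel_one_iff] at hb
    rw [b_inv_mem_coneLevel_one_iff, b_inv_mem_coneLevel_one_iff] at hb'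
    unfold vertexType
    grind
  · exact (coneType_eq_iff_coneLevel_eq schreierGraph_gens_connected).2
      (isConeAutomaton_transition.coneLevel_eq schreierGraph_gens_connected h)

theorem coneType_eq_iff_of_hasType (hx : HasType x i) (hy : HasType y j) :
    coneType gens basePt x = coneType gens basePt y ↔ i = j := by
  rw [coneType_eq_iff_vertexType_eq, hasType_iff.1 hx, hasType_iff.1 hy]

end ConeTypes

section DisjointBranches

variable {x y : Vertex} {s t : F} {n : ℕ}

theorem eq_inv_of_smul_eq (hs : s ∈ coneLevel gens basePt x 1)
    (ht : t ∈ coneLevel gens basePt x 1) (hne : s ≠ t) (hst : s • x = t • x) :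
    3 / 4 ≤ x.val ∧ (s = a⁻¹ ∧ t = b⁻¹ ∨ s = b⁻¹ ∧ t = a⁻¹) := by
  have hval := congrArg Vertex.val hst
  rw [mem_coneLevel_one_iff_eq_letter] at hs ht
  grind [val_a_smul, val_a_inv_smul, val_b_smul, val_b_inv_smul, x.val_pos, x.val_lt_one]

theorem coneLevel_subset_of_white (hx : 7 / 8 ≤ x.val) (hy : 3 / 4 ≤ y.val) :
    coneLevel gens basePt x n ⊆ coneLevel gens basePt y n := by
  refine coneLevel_subset_of_simulation schreierGraph_gens_connected
    (r := fun x y => 7 / 8 ≤ x.val ∧ 3 / 4 ≤ y.val) (fun x y hxy s hs => ?_) ⟨hx, hy⟩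
  rw [mem_coneLevel_one_iff_eq_letter] at hs ⊢
  grind [val_a_inv_smul, val_b_inv_smul]

theorem disjoint_mul_a_inv_mul_b_inv (hx : 7 / 8 ≤ x.val) :
    Disjoint ((· * a⁻¹) '' coneLevel gens basePt x n) ((· * b⁻¹) '' coneLevel gens basePt x n) := by
  have hc := schreierGraph_gens_connected
  rw [Set.disjoint_left]
  rintro _ ⟨g, hg, rfl⟩ ⟨h, hh, hgh : h * b⁻¹ = g * a⁻¹⟩
  have hb : b⁻¹ • basePt = basePt :=
    eq_basePt_iff.2 (by norm_num [val_b_inv_smul, val_basePt])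
  have ha : (3 : ℝ) / 4 ≤ (a⁻¹ • basePt).val := by norm_num [val_a_inv_smul, val_basePt]
  have hend : h • basePt = g • a⁻¹ • basePt := by
    rw [← hb, ← mul_smul, hb, hgh, mul_smul]
  have hdist : (schreierGraph gens Vertex).dist basePt (a⁻¹ • basePt) = 1 := by
    have := ((mem_coneLevel_one_iff hc).1
      (a_inv_mem_coneLevel_one_iff.2 (val_basePt.ge : 1 / 2 ≤ basePt.val))).2
    rwa [SimpleGraph.dist_self, zero_add] at this
  have hg' := ((mem_coneLevel_iff hc).1 (coneLevel_subset_of_white hx ha hg)).2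
  have hh' := schreierGraph_dist_smul_le (p := basePt) (x := basePt) hc
    ((mem_coneLevel_iff hc).1 hh).1.le
  rw [hend, SimpleGraph.dist_self] at hh'
  omega

theorem hasDisjointBranches : HasDisjointBranches gens basePt := by
  intro x n s hs t ht hne
  change Disjoint _ _
  rcases eq_or_ne (s • x) (t • x) with hst | hst
  · obtain ⟨hx, hletters⟩ := eq_inv_of_smul_eq hs ht hne hst
    have hdisj := disjoint_mul_a_inv_mul_b_inv (x := a⁻¹ • x) (n := n) (by grind [val_a_inv_smul])
    simp only
    rw [← hst]
    rcases hletters with ⟨rfl, rfl⟩ | ⟨rfl, rfl⟩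
    · exact hdisj
    · rw [hst]
      exact hdisj.symm
  · rw [Set.disjoint_left]
    rintro _ ⟨g, hg, rfl⟩ ⟨h, hh, hgh : h * t = g * s⟩
    have hx : g • s • x = h • t • x := by rw [← mul_smul, ← mul_smul, hgh]
    rw [← isParentMap_parent.iterate_smul hg, ← isParentMap_parent.iterate_smul hh, hx] at hst
    exact hst rfl

end DisjointBranches

section TransitionMatrices

variable {x : Vertex} {i j : Fin 5}

theorem a_ne_b : a ≠ b := by
  intro h
  have hval := congrArg (fun s : F => (s • basePt).val) h
  norm_num [val_a_smul, val_b_smul, val_basePt] at hval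

theorem matrixAbold_apply : matrixAbold i j = ∑ s ∈ transition i j, ofF s := by
  fin_cases i <;> fin_cases j <;> simp [matrixAbold, transition, a_ne_b]

theorem matrixA_eq_map_card_transition :
    matrixA = (Matrix.of fun i j => ((transition i j).card : ℝ)).map C := by
  ext1 i j
  fin_cases i <;> fin_cases j <;> simp [matrixA, transition, a_ne_b, map_ofNat C]

/-- The numbers of vertices of type `j` that are neighbours of a vertex of type `i` and lie further
from `1/2` than it: unlike in `transition`, the letters `a⁻¹` and `b⁻¹` at a white vertex count
once. -/
def childCount : Matrix (Fin 5) (Fin 5) ℕ :=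
  !![0, 1, 0, 1, 0;
     0, 1, 0, 0, 0;
     0, 1, 1, 1, 0;
     0, 0, 1, 0, 1;
     0, 0, 0, 0, 1]

theorem matrixB_eq_map_childCount : matrixB = (childCount.map (↑· : ℕ → ℝ)).map C := by
  ext1 i j
  fin_cases i <;> fin_cases j <;> simp [matrixB, childCount]

theorem ncard_image_transition (x : Vertex) (j : Fin 5) :
    ((· • x) '' (transition (vertexType x) j : Set F)).ncard = childCount (vertexType x) j := by
  obtain ⟨i, hi⟩ : ∃ i, vertexType x = i := ⟨_, rfl⟩
  rw [hi]
  fin_cases i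
  · fin_cases j <;> simp [transition, childCount]
  · fin_cases j <;> simp [transition, childCount]
  · fin_cases j <;> simp [transition, childCount]
  · have hx := b_inv_smul_eq_a_inv_smul (vertexType_eq_three_iff.1 hi).1
    fin_cases j <;> simp [transition, childCount, Set.image_pair, hx]
  · have hx := b_inv_smul_eq_a_inv_smul (x := x) (by linarith [vertexType_eq_four_iff.1 hi])
    fin_cases j <;> simp [transition, childCount, Set.image_pair, hx]

end TransitionMatrices

section ClosedForms

theorem inv_one_sub_X_smul_matrixA_mulVec_one :
    (1 - (X : PowerSeries ℝ) • matrixA)⁻¹.mulVec 1 =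
      ![(1 - 2 * X)⁻¹, (1 - X)⁻¹, (1 - 3 * X + 2 * X ^ 2)⁻¹, (1 - 3 * X + 2 * X ^ 2)⁻¹,
        (1 - 2 * X)⁻¹] := by
  have := (matrixA_eq_map_card_transition ▸ isUnit_one_sub_X_smul_map_C _ :
    IsUnit (1 - (X : PowerSeries ℝ) • matrixA)).invertible
  have h1 : (1 - X : PowerSeries ℝ) * (1 - X)⁻¹ = 1 := PowerSeries.mul_inv_cancel _ (by simp)
  have h2 : (1 - 2 * X : PowerSeries ℝ) * (1 - 2 * X)⁻¹ = 1 :=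
    PowerSeries.mul_inv_cancel _ (by simp)
  have hinv : (1 - 3 * X + 2 * X ^ 2 : PowerSeries ℝ)⁻¹ = (1 - X)⁻¹ * (1 - 2 * X)⁻¹ := by
    rw [← PowerSeries.mul_inv_rev]
    ring_nf
  rw [hinv]
  refine Matrix.inv_mulVec_eq_vec (funext fun i => ?_)
  fin_cases i <;> simp [matrixA, Matrix.mulVec, dotProduct, Fin.sum_univ_five] <;> grind

theorem inv_one_sub_X_smul_matrixB_mulVec_one :
    (1 - (X : PowerSeries ℝ) • matrixB)⁻¹.mulVec 1 =
      ![(1 + X) * (1 - X - X ^ 2)⁻¹, (1 - X)⁻¹, (1 + X) * (1 - 2 * X + X ^ 3)⁻¹,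
        (1 - 2 * X + X ^ 3)⁻¹, (1 - X)⁻¹] := by
  have := (matrixB_eq_map_childCount ▸ isUnit_one_sub_X_smul_map_C _ :
    IsUnit (1 - (X : PowerSeries ℝ) • matrixB)).invertible
  have h1 : (1 - X : PowerSeries ℝ) * (1 - X)⁻¹ = 1 := PowerSeries.mul_inv_cancel _ (by simp)
  have h2 : (1 - X - X ^ 2 : PowerSeries ℝ) * (1 - X - X ^ 2)⁻¹ = 1 :=
    PowerSeries.mul_inv_cancel _ (by simp)
  have hinv : (1 - 2 * X + X ^ 3 : PowerSeries ℝ)⁻¹ = (1 - X - X ^ 2)⁻¹ * (1 - X)⁻¹ := by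
    rw [← PowerSeries.mul_inv_rev]
    ring_nf
  rw [hinv]
  refine Matrix.inv_mulVec_eq_vec (funext fun i => ?_)
  fin_cases i <;> simp [matrixB, Matrix.mulVec, dotProduct, Fin.sum_univ_five] <;> grind

end ClosedForms

section Growth

variable {v : Fin 5 → Vertex} {i : Fin 5} {n : ℕ}

theorem eq_basePt_of_vertexType (hv : ∀ j, vertexType (v j) = j) : v 0 = basePt :=
  eq_basePt_iff.2 (vertexType_eq_zero_iff.1 (hv 0))

theorem coneSum_gens_succ (hv : ∀ j, vertexType (v j) = j) (i : Fin 5) (n : ℕ) :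
    coneSum gens basePt (v i) (n + 1) =
      ∑ j, coneSum gens basePt (v j) n * matrixAbold i j := by
  rw [isConeAutomaton_transition.coneSum_succ hasDisjointBranches schreierGraph_gens_connected
    finite_gens hv, hv]
  exact Finset.sum_congr rfl fun j _ => by rw [matrixAbold_apply]

theorem isUnit_one_sub_X_smul_matrixAbold_transpose :
    IsUnit (1 - (X : PowerSeries (MonoidAlgebra ℤ F)) • (matrixAbold.map C).transpose) :=
  isUnit_one_sub_X_smul_map_C matrixAbold.transpose

theorem mk_coneSum_vecMul (hv : ∀ j, vertexType (v j) = j) :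
    Matrix.vecMul (fun i => PowerSeries.mk (coneSum gens basePt (v i)))
      (1 - (X : PowerSeries (MonoidAlgebra ℤ F)) • (matrixAbold.map C).transpose) = 1 := by
  rw [← Matrix.transpose_map, mk_vecMul_one_sub_X_smul_map_C (M := matrixAbold.transpose)
    (coneSum_gens_succ hv)]
  simp only [coneSum_zero schreierGraph_gens_connected, map_one]
  rfl

theorem mk_ncard_coneLevel (hv : ∀ j, vertexType (v j) = j) :
    (fun i => PowerSeries.mk fun n => ((coneLevel gens basePt (v i) n).ncard : ℝ)) =
      (1 - (X : PowerSeries ℝ) • matrixA)⁻¹.mulVec 1 := by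
  have hc := schreierGraph_gens_connected
  rw [matrixA_eq_map_card_transition, mk_eq_inv_one_sub_X_smul_map_C_mulVec fun i n => ?_]
  · simp only [coneLevel_zero hc, Set.ncard_singleton, Nat.cast_one, map_one]
    rfl
  · rw [isConeAutomaton_transition.ncard_coneLevel_succ hasDisjointBranches hc finite_gens hv, hv]
    push_cast
    rfl

theorem coneOrbitCount_gens_succ (hv : ∀ j, vertexType (v j) = j) (i : Fin 5) (n : ℕ) :
    coneOrbitCount gens basePt (v i) (n + 1) =
      ∑ j, childCount i j * coneOrbitCount gens basePt (v j) n := by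
  rw [isParentMap_parent.coneOrbitCount_succ isConeAutomaton_transition finite_gens
    ncard_image_transition hv, hv]

theorem mk_coneOrbitCount (hv : ∀ j, vertexType (v j) = j) :
    (fun i => PowerSeries.mk fun n => (coneOrbitCount gens basePt (v i) n : ℝ)) =
      (1 - (X : PowerSeries ℝ) • matrixB)⁻¹.mulVec 1 := by
  rw [matrixB_eq_map_childCount, mk_eq_inv_one_sub_X_smul_map_C_mulVec fun i n => ?_]
  · simp only [coneOrbitCount_zero schreierGraph_gens_connected, Nat.cast_one, map_one]
    rfl
  · rw [coneOrbitCount_gens_succ hv]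
    push_cast
    rfl

theorem geodesicGrowth_gens : geodesicGrowth gens basePt = (1 - 2 * X : PowerSeries ℝ)⁻¹ := by
  obtain ⟨v, hv⟩ := vertexType_surjective.hasRightInverse
  have h0 := congrFun ((mk_ncard_coneLevel hv).trans inv_one_sub_X_smul_matrixA_mulVec_one) 0
  rw [eq_basePt_of_vertexType hv] at h0
  exact (geodesicGrowth_eq_mk_ncard_coneLevel schreierGraph_gens_connected).trans h0

theorem mk_ncard_graphSphere_graphH :
    (PowerSeries.mk fun n => ((graphSphere graphH basePt n).ncard : ℝ)) =
      (1 + X) * (1 - X - X ^ 2)⁻¹ := by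
  obtain ⟨v, hv⟩ := vertexType_surjective.hasRightInverse
  refine Eq.trans ?_ (congrFun ((mk_coneOrbitCount hv).trans
    inv_one_sub_X_smul_matrixB_mulVec_one) 0)
  simp only [eq_basePt_of_vertexType hv, coneOrbitCount_eq_ncard_coneEndpoints, graphH,
    graphSphere_eq_coneEndpoints schreierGraph_gens_connected]

theorem orbitGrowth_gens :
    orbitGrowth gens basePt = (1 + X) * (1 - X - X ^ 2 : PowerSeries ℝ)⁻¹ :=
  orbitGrowth_eq_mk_ncard_graphSphere.trans mk_ncard_graphSphere_graphH

theorem ncard_graphSphere_graphH (n : ℕ) : ((graphSphere graphH basePt n).ncard : ℝ) =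
    (goldenRatio ^ (n + 2) - goldenConj ^ (n + 2)) / √5 := by
  rw [← coeff_one_add_X_mul_inv_one_sub_X_sub_X_sq, ← mk_ncard_graphSphere_graphH, coeff_mk]

theorem finite_graphSphere_graphH (n : ℕ) : (graphSphere graphH basePt n).Finite := by
  rw [graphH, graphSphere_eq_coneEndpoints schreierGraph_gens_connected]
  exact finite_coneEndpoints schreierGraph_gens_connected finite_gens

theorem ncard_graphBall_graphH (n : ℕ) : ((graphBall graphH basePt n).ncard : ℝ) =
    (goldenRatio ^ (n + 3) - goldenRatio ^ 2) / (√5 * (goldenRatio - 1)) -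
      (goldenConj ^ (n + 3) - goldenConj ^ 2) / (√5 * (goldenConj - 1)) := by
  rw [ncard_graphBall finite_graphSphere_graphH]
  push_cast
  simp only [ncard_graphSphere_graphH, sum_range_succ_goldenRatio_pow_sub_goldenConj_pow]

theorem existsUnique_isWordFor_gens {g : F} (hg : IsGeodesicOfLength gens basePt g n) :
    ∃! u : List F, IsWordFor gens u g ∧ u.length = n := by
  have hc := schreierGraph_gens_connected
  refine hasDisjointBranches.existsUnique_isWordFor hc (x := basePt) ?_
  rwa [coneLevel_basepoint hc]

end Growth

end Thompson

open Thompson PowerSeries Real in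
theorem mainTheorem4 :
    -- the orbit of `1/2` consists of the dyadic numbers in the open interval `(0, 1)`
    (∀ t : Dyadics, t ∈ MulAction.orbit F half ↔ 0 < (t.1 : ℝ) ∧ (t.1 : ℝ) < 1) ∧
    -- a geodesic is spelled by exactly one word of minimal length
    (∀ (g : F) (n : ℕ), IsGeodesicOfLength gens basePt g n →
      ∃! u : List F, IsWordFor gens u g ∧ u.length = n) ∧
    -- there are exactly five cone types
    (∀ x : Vertex, ∃! i : Fin 5, HasType x i) ∧
    (∀ i : Fin 5, ∃ x : Vertex, HasType x i) ∧
    (∀ (x y : Vertex) (i j : Fin 5), HasType x i → HasType y j →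
      (coneType gens basePt x = coneType gens basePt y ↔ i = j)) ∧
    -- recurrences and generating functions for the five cone types
    (∀ x : Fin 5 → Vertex, (∀ i, HasType (x i) i) →
      ∀ (Λ : Fin 5 → ℕ → MonoidAlgebra ℤ F) (L : Fin 5 → ℕ → ℕ),
      (∀ i n, Λ i n = coneSum gens basePt (x i) n) →
      (∀ i n, L i n = coneOrbitCount gens basePt (x i) n) →
      (∀ i, Λ i 0 = 1) ∧
      (∀ n,
        Λ 0 (n + 1) = Λ 1 n * ofF a + Λ 3 n * ofF a⁻¹ ∧
        Λ 1 (n + 1) = Λ 1 n * ofF a ∧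
        Λ 2 (n + 1) = Λ 1 n * ofF a + Λ 2 n * ofF b + Λ 3 n * ofF a⁻¹ ∧
        Λ 3 (n + 1) = Λ 2 n * ofF b + Λ 4 n * (ofF a⁻¹ + ofF b⁻¹) ∧
        Λ 4 (n + 1) = Λ 4 n * (ofF a⁻¹ + ofF b⁻¹)) ∧
      (∀ i, L i 0 = 1) ∧
      (∀ n,
        L 0 (n + 1) = L 1 n + L 3 n ∧
        L 1 (n + 1) = L 1 n ∧
        L 2 (n + 1) = L 1 n + L 2 n + L 3 n ∧
        L 3 (n + 1) = L 2 n + L 4 n ∧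
        L 4 (n + 1) = L 4 n) ∧
      -- the extended complete geodesic growth function; coefficients multiply from the right
      (IsUnit (1 - (X : PowerSeries (MonoidAlgebra ℤ F)) • (matrixAbold.map C).transpose) ∧
        Matrix.vecMul (fun i => PowerSeries.mk (Λ i))
          (1 - (X : PowerSeries (MonoidAlgebra ℤ F)) • (matrixAbold.map C).transpose) = 1) ∧
      completeGeodesicGrowth gens basePt = PowerSeries.mk (Λ 0) ∧
      -- the numbers of geodesics
      (fun i => PowerSeries.mk fun n => ((coneLevel gens basePt (x i) n).ncard : ℝ)) =
        (1 - (X : PowerSeries ℝ) • matrixA)⁻¹.mulVec 1 ∧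
      (fun i => PowerSeries.mk fun n => ((coneLevel gens basePt (x i) n).ncard : ℝ)) =
        ![(1 - 2 * X : PowerSeries ℝ)⁻¹, (1 - X)⁻¹, (1 - 3 * X + 2 * X ^ 2)⁻¹,
          (1 - 3 * X + 2 * X ^ 2)⁻¹, (1 - 2 * X)⁻¹] ∧
      -- the numbers of end points
      (fun i => PowerSeries.mk fun n => (L i n : ℝ)) =
        (1 - (X : PowerSeries ℝ) • matrixB)⁻¹.mulVec 1 ∧
      (fun i => PowerSeries.mk fun n => (L i n : ℝ)) =
        ![(1 + X) * (1 - X - X ^ 2 : PowerSeries ℝ)⁻¹, (1 - X)⁻¹,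
          (1 + X) * (1 - 2 * X + X ^ 3)⁻¹, (1 - 2 * X + X ^ 3)⁻¹, (1 - X)⁻¹]) ∧
    -- geodesic growth and orbit growth
    geodesicGrowth gens basePt = (1 - 2 * X : PowerSeries ℝ)⁻¹ ∧
    orbitGrowth gens basePt = (1 + X) * (1 - X - X ^ 2 : PowerSeries ℝ)⁻¹ ∧
    orbitGrowth gens basePt =
      C (goldenRatio ^ 2 / √5) * (1 - C goldenRatio * X)⁻¹ -
        C (goldenConj ^ 2 / √5) * (1 - C goldenConj * X)⁻¹ ∧
    -- spheres and balls
    (∀ n : ℕ, ((graphSphere graphH basePt n).ncard : ℝ) =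
      (goldenRatio ^ (n + 2) - goldenConj ^ (n + 2)) / √5) ∧
    (∀ n : ℕ, ((graphBall graphH basePt n).ncard : ℝ) =
      (goldenRatio ^ (n + 3) - goldenRatio ^ 2) / (√5 * (goldenRatio - 1)) -
        (goldenConj ^ (n + 3) - goldenConj ^ 2) / (√5 * (goldenConj - 1))) := by
  have hc := schreierGraph_gens_connected
  refine ⟨fun _ => mem_orbit_half_iff, fun g n => existsUnique_isWordFor_gens,
    existsUnique_hasType, exists_hasType, fun x y i j => coneType_eq_iff_of_hasType,
    fun x hx Λ L hΛ hL => ?_, geodesicGrowth_gens, orbitGrowth_gens,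
    orbitGrowth_gens.trans one_add_X_mul_inv_one_sub_X_sub_X_sq, ncard_graphSphere_graphH,
    ncard_graphBall_graphH⟩
  obtain rfl : Λ = fun i => coneSum gens basePt (x i) := funext₂ hΛ
  obtain rfl : L = fun i => coneOrbitCount gens basePt (x i) := funext₂ hL
  have hv (i : Fin 5) : vertexType (x i) = i := hasType_iff.1 (hx i)
  refine ⟨fun i => coneSum_zero hc, fun n => ?_, fun i => coneOrbitCount_zero hc, fun n => ?_,
    ⟨isUnit_one_sub_X_smul_matrixAbold_transpose, mk_coneSum_vecMul hv⟩, ?_,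
    mk_ncard_coneLevel hv, (mk_ncard_coneLevel hv).trans inv_one_sub_X_smul_matrixA_mulVec_one,
    mk_coneOrbitCount hv, (mk_coneOrbitCount hv).trans inv_one_sub_X_smul_matrixB_mulVec_one⟩
  · simp [coneSum_gens_succ hv, matrixAbold, Fin.sum_univ_five]
  · simp [coneOrbitCount_gens_succ hv, childCount, Fin.sum_univ_five]
  · simp only [completeGeodesicGrowth_eq_mk_coneSum hc, eq_basePt_of_vertexType hv]
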